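/- Let $f:\mathbb R^m\to\mathbb R^m$ be $C^\infty$, and let $f=f_a^++f_a^-$ be flux splittings, $C^\infty$ jointly in the state and in a real parameter $a$ (for instance the Lax--Friedrichs splitting $f_a^\pm(w)=\tfrac12(f(w)\pm a\,w)$). Let $\Omega\subseteq\mathbb R$ be open, $T>0$, and let $u:\Omega\times[0,T]\to\mathbb R^m$ be a $C^\infty$ solution of $u_t+f(u)_x=0$. Fix $R\ge1$, $\tau>0$, $\varepsilon>0$ and an integer $p\ge0$, and put $r=\lceil\frac{R+1}2\rceil$. *Finite differences.* For $k,q\ge1$ let $s=\lfloor\frac{k-1}2\rfloor+q$ and let $\Delta_h^{k,q}v=h^{-k}\sum_{l=-s}^{s}\beta_l\,v_l$, where the $\beta_l=\beta_l^{k,q}$ are determined by $\sum_{l=-s}^{s}\beta_l\,l^{\nu}=0$ for $0\le\nu\le2s$, $\nu\ne k$, and $\sum_{l=-s}^{s}\beta_l\,l^{k}=k!$; this is the centered difference that approximates $k$-th derivatives to order $2q$. *WENO flux.* For scalar data $(w_j)_{j\in\mathbb Z}$ and $0\le k<r$ let $q_k$ be the polynomial of degree less than $r$ whose average over $[j-\frac12,j+\frac12]$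 is $w_j$ for $j=k-r+1,\dots,k$. Put $d_k=\binom rk\binom{r-1}k/\binom{2r-1}r$, $\;\beta_k^{JS}=\sum_{l=1}^{r-1}\int_{-1/2}^{1/2}(q_k^{(l)}(y))^2\,dy$, $\;\alpha_k=d_k/(\varepsilon+\beta_k^{JS})^p$ and $W(w)=\sum_k\frac{\alpha_k}{\sum_j\alpha_j}\,q_k(\tfrac12)$ (the Jiang--Shu WENO reconstruction of order $2r-1$). For grid data $v=(v_i)_{i\in\mathbb Z}$ in $\mathbb R^m$ the numerical flux is, componentwise, $\hat f_{i+1/2}=W\big((f_a^+(v_{i+j}))_j\big)+W\big((f_a^-(v_{i+1-j}))_j\big)$. *Scheme.* With space step $h$ and time step $\delta=\Delta t=\tau h$, put $\tilde u_i^{(0)}=v_i$, $\tilde u_i^{(1)}=-(\hat f_{i+1/2}-\hat f_{i-1/2})/h$ and, for $1\le k\le R-1$, $$\tilde f_i^{(k)}=\Delta_\delta^{k,\lceil\frac{R-k}2\rceil}\big(f(T_{k,i}(j\delta))\big)_{j},\qquad T_{k,i}(\rho)=\sum_{l=0}^k\frac{\tilde u_i^{(l)}}{l!}\rho^l,\qquad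 \tilde u_i^{(k+1)}=-\Delta_h^{1,\lceil\frac{R-k}2\rceil}\big(\tilde f_{i+j}^{(k)}\big)_{j}.$$ The scheme replaces $v_i$ by $v_i+\sum_{l=1}^R\frac{\delta^l}{l!}\tilde u_i^{(l)}$. *Claim.* The scheme is $R$-th order accurate, that is, its local truncation error is $O(h^{R+1})$: for every compact $K\subset\Omega$ and every $A$ there are $C$ and $h_0>0$ such that for all $0<h<h_0$, all $a$ with $|a|\le A$, all $x\in K$ and all $t\ge0$ with $t+\tau h\le T$, with the scheme applied to the exact data $v_i=u(x+ih,t)$, $$\Big\|u(x,t+\tau h)-\Big(v_0+\sum_{l=1}^R\frac{(\tau h)^l}{l!}\tilde u_0^{(l)}\Big)\Big\|\le C\,h^{R+1}.$$ -/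

import Mathlib

open Polynomial
open scoped ContDiff

noncomputable section

/-! ### Centered finite differences -/

/-- Half-width `s = ⌊(p-1)/2⌋ + q` of the centered stencil that approximates a `p`-th derivative to
order `2 q`. -/
def fdWidth (p q : ℕ) : ℕ := (p - 1) / 2 + q

/-- The coefficients `β_l^{p,q}`, `-s ≤ l ≤ s`, of the centered difference: the `p`-th derivative
at `0` of the Lagrange basis polynomial of the node `l` on the nodes `-s, …, s`. They are the
solution of the moment system in `sum_fdCoeff_mul_pow`. -/
def fdCoeff (p q : ℕ) (l : ℤ) : ℝ :=
  (derivative^[p] (Lagrange.basis (Finset.Icc (-(fdWidth p q : ℤ)) (fdWidth p q))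
    (fun j : ℤ => (j : ℝ)) l)).eval 0

/-- The moment system that determines the coefficients of the centered difference. -/
theorem sum_fdCoeff_mul_pow (p q n : ℕ) (hn : n ≤ 2 * fdWidth p q) :
    ∑ l ∈ Finset.Icc (-(fdWidth p q : ℤ)) (fdWidth p q), fdCoeff p q l * (l : ℝ) ^ n =
      if n = p then (p.factorial : ℝ) else 0 := by
  have hinj : Set.InjOn (fun j : ℤ => (j : ℝ))
      (Finset.Icc (-(fdWidth p q : ℤ)) (fdWidth p q) : Finset ℤ) :=
    fun a _ b _ hab => by simpa using hab
  have hdeg : (X ^ n : ℝ[X]).degree <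
      ((Finset.Icc (-(fdWidth p q : ℤ)) (fdWidth p q)).card : WithBot ℕ) := by
    rw [degree_X_pow, Int.card_Icc]
    exact_mod_cast (by omega)
  have h := Lagrange.eq_interpolate hinj hdeg
  rw [Lagrange.interpolate_apply] at h
  have h2 := congrArg (fun P : ℝ[X] => (derivative^[p] P).eval 0) h
  simp only [iterate_derivative_sum, iterate_derivative_C_mul, eval_finsetSum, eval_mul, eval_C,
    eval_pow, eval_X] at h2
  calc _ = ∑ l ∈ Finset.Icc (-(fdWidth p q : ℤ)) (fdWidth p q),
      (l : ℝ) ^ n * fdCoeff p q l := Finset.sum_congr rfl fun _ _ => mul_comm _ _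
    _ = _ := h2.symm
    _ = _ := by
      rw [iterate_derivative_X_pow_eq_smul]
      split_ifs with hnp
      · subst hnp
        simp [Nat.descFactorial_self]
      · rcases lt_or_gt_of_ne hnp with hlt | hgt
        · simp [Nat.descFactorial_of_lt hlt]
        · simp [Nat.sub_ne_zero_of_lt hgt]

/-- The centered finite difference `Δ_h^{p,q} v = h⁻ᵖ ∑_{l=-s}^{s} β_l^{p,q} v_l`. -/
def centralDiff {E : Type*} [AddCommGroup E] [Module ℝ E] (p q : ℕ) (h : ℝ) (v : ℤ → E) : E :=
  (h ^ p)⁻¹ • ∑ l ∈ Finset.Icc (-(fdWidth p q : ℤ)) (fdWidth p q), fdCoeff p q l • v l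

/-! ### WENO reconstructions

The cell with index `j` is rescaled to `[j - 1/2, j + 1/2]`. -/

/-- The polynomial of degree less than `n` whose averages over the `n` cells `a, …, a + n - 1` are
`w a, …, w (a + n - 1)`: the derivative of the interpolant, at the cell interfaces, of the
primitive. -/
def recPoly (n : ℕ) (a : ℤ) (w : ℤ → ℝ) : ℝ[X] :=
  derivative (Lagrange.interpolate (Finset.range (n + 1)) (fun j : ℕ => (a : ℝ) + j - 1 / 2)
    (fun j : ℕ => ∑ i ∈ Finset.range j, w (a + i)))

theorem integral_recPoly (n : ℕ) (a : ℤ) (w : ℤ → ℝ) (j : ℕ) (hj : j < n) :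
    ∫ y in ((a : ℝ) + j - 1 / 2)..((a : ℝ) + j + 1 / 2), (recPoly n a w).eval y = w (a + j) := by
  have hinj : Set.InjOn (fun j : ℕ => (a : ℝ) + j - 1 / 2) (Finset.range (n + 1)) :=
    fun x _ y _ hxy => by
      have : (x : ℝ) = y := by simpa using hxy
      exact_mod_cast this
  unfold recPoly
  rw [intervalIntegral.integral_eq_sub_of_hasDerivAt (fun y _ => Polynomial.hasDerivAt _ y)
    ((Polynomial.continuous _).intervalIntegrable _ _)]
  have e : (a : ℝ) + j + 1 / 2 = (a : ℝ) + (j + 1 : ℕ) - 1 / 2 := by push_cast; ring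
  rw [e, Lagrange.eval_interpolate_at_node _ hinj (Finset.mem_range.2 (by omega : j + 1 < n + 1)),
    Lagrange.eval_interpolate_at_node _ hinj (Finset.mem_range.2 (by omega : j < n + 1)),
    Finset.sum_range_succ]
  ring

/-- The candidate polynomial number `k` (`0 ≤ k < r`) for the interface `1/2`; its stencil consists
of the `r` cells `k - r + 1, …, k`. -/
def wenoPoly (r k : ℕ) (w : ℤ → ℝ) : ℝ[X] := recPoly r ((k : ℤ) - r + 1) w

/-- The optimal linear weights, for which `∑ k, d_k • (candidate k)` takes at `1/2` the same value
as the reconstruction from all `2 r - 1` cells. -/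
def wenoLinearWeight (r k : ℕ) : ℝ :=
  ((r.choose k : ℝ) * ((r - 1).choose k : ℝ)) / ((2 * r - 1).choose r : ℝ)

/-- The Jiang-Shu smoothness indicators. -/
def wenoIndicator (r k : ℕ) (w : ℤ → ℝ) : ℝ :=
  ∑ l ∈ Finset.Icc 1 (r - 1),
    ∫ y in (-(1 / 2) : ℝ)..(1 / 2), ((derivative^[l] (wenoPoly r k w)).eval y) ^ 2

/-- The unnormalized nonlinear weights `d_k / (ε + β_k) ^ p`. -/
def wenoAlpha (r p : ℕ) (ε : ℝ) (k : ℕ) (w : ℤ → ℝ) : ℝ :=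
  wenoLinearWeight r k / (ε + wenoIndicator r k w) ^ p

/-- The nonlinear weights. -/
def wenoWeight (r p : ℕ) (ε : ℝ) (k : ℕ) (w : ℤ → ℝ) : ℝ :=
  wenoAlpha r p ε k w / ∑ j ∈ Finset.range r, wenoAlpha r p ε j w

/-- The left-biased WENO reconstruction of order `2 r - 1` at the right interface `1/2` of the
cell `0`. -/
def wenoRec (r p : ℕ) (ε : ℝ) (w : ℤ → ℝ) : ℝ :=
  ∑ k ∈ Finset.range r, wenoWeight r p ε k w * (wenoPoly r k w).eval (1 / 2)

/-- The numerical flux at the interface `i + 1/2` for the split flux `f = fp + fm`: the components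
of `fp` are reconstructed with left bias, and those of `fm` with right bias. It depends on the data
`v_{i-r+1}, …, v_{i+r}` only. -/
def wenoFlux {m : ℕ} (r p : ℕ) (ε : ℝ) (fp fm : (Fin m → ℝ) → (Fin m → ℝ)) (v : ℤ → Fin m → ℝ)
    (i : ℤ) : Fin m → ℝ :=
  fun c => wenoRec r p ε (fun j => fp (v (i + j)) c) + wenoRec r p ε (fun j => fm (v (i + 1 - j)) c)

/-! ### The approximate Lax-Wendroff-type scheme -/

/-- The Taylor polynomial `∑_{l ≤ k} (w_l / l!) ρ ^ l`. -/
def taylorPoly {m : ℕ} (k : ℕ) (w : ℕ → Fin m → ℝ) (ρ : ℝ) : Fin m → ℝ :=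
  ∑ l ∈ Finset.range (k + 1), (ρ ^ l / (l.factorial : ℝ)) • w l

/-- The approximation of the `k`-th time derivative of the flux, for `1 ≤ k < R`, from
approximations `w_0, …, w_k` of the time derivatives of the solution. -/
def approxFluxDeriv {m : ℕ} (R : ℕ) (f : (Fin m → ℝ) → (Fin m → ℝ)) (δ : ℝ) (k : ℕ)
    (w : ℕ → Fin m → ℝ) : Fin m → ℝ :=
  centralDiff k ((R - k) ⌈/⌉ 2) δ (fun j : ℤ => f (taylorPoly k w (j * δ)))

/-- The approximation at the node `i` of the `k`-th time derivative of the solution, `0 ≤ k ≤ R`,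
from the data `v`. The truncation to `l < k + 2` in the recursion only serves its termination, see
`approxDeriv_add_two`. -/
def approxDeriv {m : ℕ} (R p : ℕ) (ε : ℝ) (f fp fm : (Fin m → ℝ) → (Fin m → ℝ)) (h δ : ℝ)
    (v : ℤ → Fin m → ℝ) : ℕ → ℤ → Fin m → ℝ
  | 0, i => v i
  | 1, i => -(h⁻¹ • (wenoFlux ((R + 1) ⌈/⌉ 2) p ε fp fm v i -
      wenoFlux ((R + 1) ⌈/⌉ 2) p ε fp fm v (i - 1)))
  | k + 2, i => -(centralDiff 1 ((R - (k + 1)) ⌈/⌉ 2) h (fun j : ℤ =>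
      approxFluxDeriv R f δ (k + 1)
        (fun l => if l < k + 2 then approxDeriv R p ε f fp fm h δ v l (i + j) else 0)))

theorem approxDeriv_add_two {m : ℕ} (R p : ℕ) (ε : ℝ) (f fp fm : (Fin m → ℝ) → (Fin m → ℝ))
    (h δ : ℝ) (v : ℤ → Fin m → ℝ) (k : ℕ) (i : ℤ) :
    approxDeriv R p ε f fp fm h δ v (k + 2) i =
      -(centralDiff 1 ((R - (k + 1)) ⌈/⌉ 2) h (fun j : ℤ => approxFluxDeriv R f δ (k + 1)
        (fun l => approxDeriv R p ε f fp fm h δ v l (i + j)))) := by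
  rw [approxDeriv]
  congr 2
  funext j
  unfold approxFluxDeriv taylorPoly
  congr 1
  funext j'
  congr 1
  refine Finset.sum_congr rfl fun l hl => ?_
  have hl' : l < k + 2 := Finset.mem_range.1 hl
  simp only [hl', if_true]

/-- One time step of the scheme. -/
def lwStep {m : ℕ} (R p : ℕ) (ε : ℝ) (f fp fm : (Fin m → ℝ) → (Fin m → ℝ)) (h δ : ℝ)
    (v : ℤ → Fin m → ℝ) (i : ℤ) : Fin m → ℝ :=
  v i + ∑ l ∈ Finset.Icc 1 R, (δ ^ l / (l.factorial : ℝ)) • approxDeriv R p ε f fp fm h δ v l i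

end

noncomputable section

open Asymptotics Filter Topology

/-! ### Taylor expansions along chains of derivatives -/

/-! The approximate derivatives lose one order per level: at every node the `l`-th one equals `∂_t^l
u + O(h^(R+1-l))` (`isBigO_approxDeriv_sub`). The factor `δ^l` of the update restores `h^(R+1)`, and
the Taylor remainder of `u` in time has the same size.

Level 1. Pointwise accuracy `2r-1` of the interface values does not suffice in general, since the
flux difference is divided by `h`. But the difference of two neighbouring linear reconstructions
from `2r-1` cells is exact for polynomials of degree `2r-1` (`eval_recPoly_sub_shift`), so its error
is `O(h^(2r))`. The optimal weights combine the candidates into this linear reconstruction by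
Vandermonde's identity (`sum_wenoLinearWeight_mul_eval`). As `ε` is fixed, candidate values and
nonlinear weights deviate from their linear counterparts by `O(h^r)`; both families of weights sum
to 1, so only products of the two deviations enter, again `O(h^(2r))` (`isBigO_wenoRec_sub`).
Finally `2r ≥ R+1`.

From level `k` to `k+1` (`isBigO_recursion`). An error `h^(R+1-l)` in the `l`-th Taylor coefficient
is multiplied by `ρ^l = O(h^l)`, so flux values are perturbed by `O(h^(R+1))`. The Taylor polynomial
has the correct first `k` derivatives, hence so has the flux along it. The truncation defect of the
time difference may be only `O(h^R)` before division by `δ^k`, one power too few; but it is smooth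
in `x`, and the outer space difference annihilates constants, so only its variation between nodes of
the stencil matters, and that is `O(h^(R+1))` (`isBigO_fluxDefect_sub`). Division by `δ^k h` leaves
`O(h^(R-k))`.

Derivatives of compositions are handled by `jetComp`, which iterates `f ↦ ((x, v) ↦ f'(x) v)` on
pairs; smoothness and the chain rule then follow by induction, without Faà di Bruno's formula.
Uniformity in `x`, `t` and `a` is encoded in `stepFilter`, whose principal factor turns `=O` into a
bound with one constant. -/

/-- The derivative of the remainder is the remainder of the shifted chain, so the mean value
inequality on a segment adds one factor `|z - y|` per induction step. The factor `1 / n!` is given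
up. Derivatives within `D` make it usable up to the endpoints of `[0, T]`. -/
theorem norm_sub_taylor_le {E : Type*} [NormedAddCommGroup E] [NormedSpace ℝ E] {D : Set ℝ}
    (hD : Convex ℝ D) {C : ℝ} (n : ℕ) (g : ℕ → ℝ → E)
    (hg : ∀ l < n, ∀ z ∈ D, HasDerivWithinAt (g l) (g (l + 1) z) D z)
    (hb : ∀ z ∈ D, ‖g n z‖ ≤ C) {y z : ℝ} (hy : y ∈ D) (hz : z ∈ D) :
    ‖g 0 z - ∑ l ∈ Finset.range n, ((z - y) ^ l / (l.factorial : ℝ)) • g l y‖ ≤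
      C * |z - y| ^ n := by
  induction n generalizing g z with
  | zero => simpa using hb z hz
  | succ n ih =>
    have hseg : segment ℝ y z ⊆ D := hD.segment_subset hy hz
    have hC : 0 ≤ C := (norm_nonneg _).trans (hb y hy)
    have hder : ∀ x ∈ segment ℝ y z, HasDerivWithinAt
        (fun x => g 0 x - ∑ l ∈ Finset.range (n + 1), ((x - y) ^ l / (l.factorial : ℝ)) • g l y)
        (g 1 x - ∑ l ∈ Finset.range n, ((x - y) ^ l / (l.factorial : ℝ)) • g (l + 1) y)
        (segment ℝ y z) x := by
      intro x hx
      refine ((hg 0 n.succ_pos x (hseg hx)).mono hseg).fun_sub ?_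
      have h1 : ∀ l ∈ Finset.range (n + 1), HasDerivWithinAt
          (fun x => ((x - y) ^ l / (l.factorial : ℝ)) • g l y)
          (((l : ℝ) * (x - y) ^ (l - 1) / (l.factorial : ℝ)) • g l y) (segment ℝ y z) x := by
        intro l _
        have := (((((hasDerivAt_id x).sub_const y).pow l).div_const
          (l.factorial : ℝ)).smul_const (g l y)).hasDerivWithinAt (s := segment ℝ y z)
        simpa using this
      convert HasDerivWithinAt.fun_sum h1 using 1
      rw [Finset.sum_range_succ']
      simp only [Nat.cast_zero, zero_mul, zero_div, zero_smul, add_zero]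
      refine Finset.sum_congr rfl fun l _ => ?_
      congr 1
      rw [Nat.factorial_succ]
      have : (l.factorial : ℝ) ≠ 0 := by positivity
      push_cast
      field_simp
    have hbound : ∀ x ∈ segment ℝ y z,
        ‖g 1 x - ∑ l ∈ Finset.range n, ((x - y) ^ l / (l.factorial : ℝ)) • g (l + 1) y‖ ≤
          C * |z - y| ^ n := by
      intro x hx
      refine (ih (fun l => g (l + 1)) (fun l hl => hg (l + 1) (by omega)) hb (hseg hx)).trans ?_
      have : |x - y| ≤ |z - y| := by
        have := norm_sub_le_of_mem_segment hx
        simpa [Real.norm_eq_abs, abs_sub_comm] using this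
      gcongr
    have := (convex_segment y z).norm_image_sub_le_of_norm_hasDerivWithin_le hder hbound
      (left_mem_segment ℝ y z) (right_mem_segment ℝ y z)
    rw [Finset.sum_range_succ' (fun l => ((y - y) ^ l / (l.factorial : ℝ)) • g l y)] at this
    simp only [sub_self, ne_eq, Nat.add_eq_zero_iff, one_ne_zero, and_false, not_false_eq_true,
      zero_pow, zero_div, zero_smul, Finset.sum_const_zero, pow_zero, Nat.factorial_zero,
      Nat.cast_one, div_one, one_smul, zero_add, sub_zero] at this
    calc _ ≤ _ := this
      _ = _ := by rw [Real.norm_eq_abs]; ring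

/-- A linear combination of values whose moments select the `k`-th derivative. -/
theorem norm_sum_smul_sub_deriv_le {E : Type*} [NormedAddCommGroup E] [NormedSpace ℝ E] {D : Set ℝ}
    (hD : Convex ℝ D) {C : ℝ} (n k : ℕ) (hk : k < n) (s : Finset ℤ) (c : ℤ → ℝ)
    (hc : ∀ l < n, ∑ j ∈ s, c j * (j : ℝ) ^ l = if l = k then (k.factorial : ℝ) else 0)
    (g : ℕ → ℝ → E)
    (hg : ∀ l < n, ∀ z ∈ D, HasDerivWithinAt (g l) (g (l + 1) z) D z)
    (hb : ∀ z ∈ D, ‖g n z‖ ≤ C) {y h : ℝ} (hy : y ∈ D) (hz : ∀ j ∈ s, y + j * h ∈ D) :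
    ‖∑ j ∈ s, c j • g 0 (y + j * h) - h ^ k • g k y‖ ≤
      (C * ∑ j ∈ s, |c j| * |(j : ℝ)| ^ n) * |h| ^ n := by
  -- By the moment conditions the combination is exact on the Taylor polynomial, so only the
  -- remainders at the nodes are left.
  have e : h ^ k • g k y = ∑ j ∈ s, c j •
      ∑ l ∈ Finset.range n, ((y + j * h - y) ^ l / (l.factorial : ℝ)) • g l y := by
    simp only [Finset.smul_sum, smul_smul]
    rw [Finset.sum_comm]
    have : ∀ l ∈ Finset.range n,
        ∑ j ∈ s, (c j * ((y + j * h - y) ^ l / (l.factorial : ℝ))) • g l y =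
        if l = k then h ^ k • g k y else 0 := by
      intro l hl
      rw [← Finset.sum_smul]
      have h2 : ∑ j ∈ s, c j * ((y + j * h - y) ^ l / (l.factorial : ℝ)) =
          (∑ j ∈ s, c j * (j : ℝ) ^ l) * (h ^ l / (l.factorial : ℝ)) := by
        rw [Finset.sum_mul]
        refine Finset.sum_congr rfl fun j _ => ?_
        rw [add_sub_cancel_left, mul_pow]; ring
      rw [h2, hc l (Finset.mem_range.1 hl)]
      split_ifs with h3
      · subst h3
        congr 1
        have : (l.factorial : ℝ) ≠ 0 := by positivity
        field_simp
      · simp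
    rw [Finset.sum_congr rfl this, Finset.sum_ite_eq' _ k, if_pos (Finset.mem_range.2 hk)]
  rw [e, ← Finset.sum_sub_distrib, Finset.mul_sum, Finset.sum_mul]
  refine (norm_sum_le _ _).trans (Finset.sum_le_sum fun j hj => ?_)
  rw [← smul_sub, norm_smul, Real.norm_eq_abs]
  have := norm_sub_taylor_le hD n g hg hb hy (hz j hj)
  rw [add_sub_cancel_left] at this ⊢
  calc _ ≤ |c j| * (C * |j * h| ^ n) := by gcongr
    _ = _ := by rw [abs_mul, mul_pow]; ring

/-! ### Moments of the centered differences -/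

theorem injOn_intCast (s : Finset ℤ) : Set.InjOn (fun j : ℤ => (j : ℝ)) s :=
  fun a _ b _ hab => by simpa using hab

/-- Vanishing moments mean that `c` annihilates all polynomials of degree at most `2 N`; the
Lagrange basis polynomial of the node `l` isolates `c l`. -/
theorem eq_zero_of_moments_eq_zero {N : ℕ} {c : ℤ → ℝ}
    (h : ∀ n ≤ 2 * N, ∑ l ∈ Finset.Icc (-(N : ℤ)) N, c l * (l : ℝ) ^ n = 0)
    {l : ℤ} (hl : l ∈ Finset.Icc (-(N : ℤ)) N) : c l = 0 := by
  set s := Finset.Icc (-(N : ℤ)) N with hs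
  have hP : ∀ P : ℝ[X], P.natDegree < 2 * N + 1 → ∑ j ∈ s, c j * P.eval (j : ℝ) = 0 := by
    intro P hP
    simp only [eval_eq_sum_range' hP, Finset.mul_sum]
    rw [Finset.sum_comm]
    refine Finset.sum_eq_zero fun n hn => ?_
    have := h n (by have := Finset.mem_range.1 hn; omega)
    calc _ = P.coeff n * ∑ j ∈ s, c j * (j : ℝ) ^ n := by
          rw [Finset.mul_sum]; exact Finset.sum_congr rfl fun _ _ => by ring
      _ = 0 := by rw [this, mul_zero]
  have h1 := hP (Lagrange.basis s (fun j : ℤ => (j : ℝ)) l) (by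
    rw [Lagrange.natDegree_basis (injOn_intCast s) hl, hs, Int.card_Icc]; omega)
  rw [Finset.sum_eq_single l] at h1
  · simpa [Lagrange.eval_basis_self (injOn_intCast s) hl] using h1
  · intro j hj hjl
    have := Lagrange.eval_basis_of_ne (v := fun j : ℤ => (j : ℝ)) (Ne.symm hjl) hj
    rw [this, mul_zero]
  · exact fun h => absurd hl h

theorem sum_Icc_neg (N : ℕ) (F : ℤ → ℝ) :
    ∑ l ∈ Finset.Icc (-(N : ℤ)) N, F (-l) = ∑ l ∈ Finset.Icc (-(N : ℤ)) N, F l := by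
  refine Finset.sum_nbij' (fun l => -l) (fun l => -l) ?_ ?_ ?_ ?_ ?_ <;>
    simp only [Finset.mem_Icc, neg_neg, implies_true] <;> intros <;> omega

/-- For even `p` the reflected coefficients solve the same moment system, whose solution is unique.
-/
theorem fdCoeff_neg {p : ℕ} (hp : Even p) (q : ℕ) {l : ℤ}
    (hl : l ∈ Finset.Icc (-(fdWidth p q : ℤ)) (fdWidth p q)) :
    fdCoeff p q (-l) = fdCoeff p q l := by
  refine sub_eq_zero.1 (eq_zero_of_moments_eq_zero (N := fdWidth p q)
    (c := fun l => fdCoeff p q (-l) - fdCoeff p q l) (fun n hn => ?_) hl)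
  simp only [sub_mul, Finset.sum_sub_distrib]
  have h1 := sum_Icc_neg (fdWidth p q) (fun l => (-1) ^ n * (fdCoeff p q l * (l : ℝ) ^ n))
  have h2 : ∀ l : ℤ, (-1 : ℝ) ^ n * (fdCoeff p q (-l) * ((-l : ℤ) : ℝ) ^ n) =
      fdCoeff p q (-l) * (l : ℝ) ^ n := by
    intro l
    rw [Int.cast_neg, neg_pow (l : ℝ), mul_left_comm, ← mul_assoc ((-1 : ℝ) ^ n), ← mul_pow]
    simp
  simp only [h2] at h1
  rw [h1, ← Finset.mul_sum, sum_fdCoeff_mul_pow p q n hn]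
  split_ifs with h
  · subst h; simp [hp.neg_one_pow]
  · simp

/-- For odd `p` the defining system reaches up to `2 s = p + 2 q - 1`. For even `p` it stops one
short, at `p + 2 q - 2`; the missing moment is odd and vanishes by symmetry. -/
theorem sum_fdCoeff_mul_pow_of_lt {p q : ℕ} (hp : 1 ≤ p) (hq : 1 ≤ q) (n : ℕ)
    (hn : n < p + 2 * q) :
    ∑ l ∈ Finset.Icc (-(fdWidth p q : ℤ)) (fdWidth p q), fdCoeff p q l * (l : ℝ) ^ n =
      if n = p then (p.factorial : ℝ) else 0 := by
  rcases le_or_gt n (2 * fdWidth p q) with h | h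
  · exact sum_fdCoeff_mul_pow p q n h
  · have hw : fdWidth p q = (p - 1) / 2 + q := rfl
    have hpe : Even p := by
      rcases Nat.even_or_odd p with h' | ⟨m, hm⟩
      · exact h'
      · omega
    have hn1 : Odd n := by
      obtain ⟨m, hm⟩ := hpe
      exact ⟨fdWidth p q, by omega⟩
    rw [if_neg (by omega)]
    have h1 := sum_Icc_neg (fdWidth p q) (fun l => fdCoeff p q l * (l : ℝ) ^ n)
    have h2 : ∑ l ∈ Finset.Icc (-(fdWidth p q : ℤ)) (fdWidth p q),
        fdCoeff p q (-l) * ((-l : ℤ) : ℝ) ^ n =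
        -∑ l ∈ Finset.Icc (-(fdWidth p q : ℤ)) (fdWidth p q), fdCoeff p q l * (l : ℝ) ^ n := by
      rw [← Finset.sum_neg_distrib]
      refine Finset.sum_congr rfl fun l hl => ?_
      rw [fdCoeff_neg hpe q hl, Int.cast_neg, hn1.neg_pow]; ring
    rw [h2] at h1
    linarith

/-! ### Reconstruction polynomials -/

theorem injOn_cellNode (n : ℕ) (a : ℝ) :
    Set.InjOn (fun j : ℕ => a + j - 1 / 2) (Finset.range (n + 1)) := fun x _ y _ hxy => by
  have : (x : ℝ) = y := by simpa using hxy
  exact_mod_cast this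

/-- The reconstruction polynomial as a linear function of the data. -/
def recPolyLin (n : ℕ) (a : ℤ) : (ℤ → ℝ) →ₗ[ℝ] ℝ[X] where
  toFun := recPoly n a
  map_add' w w' := by
    unfold recPoly
    rw [← derivative_add, ← map_add]
    congr 2
    funext j
    simp [Finset.sum_add_distrib]
  map_smul' c w := by
    unfold recPoly
    rw [RingHom.id_apply, ← derivative_smul, ← map_smul]
    congr 2
    funext j
    simp [Finset.mul_sum]

theorem recPolyLin_apply (n : ℕ) (a : ℤ) (w : ℤ → ℝ) : recPolyLin n a w = recPoly n a w := rfl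

theorem recPoly_congr {n : ℕ} {a : ℤ} {w w' : ℤ → ℝ} (h : ∀ i < n, w (a + i) = w' (a + i)) :
    recPoly n a w = recPoly n a w' := by
  unfold recPoly
  congr 1
  refine Lagrange.interpolate_eq_of_values_eq_on _ _ fun j hj => Finset.sum_congr rfl fun i hi => ?_
  refine h i ?_
  rw [Finset.mem_range] at hj hi
  omega

theorem recPoly_eq_sum (n : ℕ) (a : ℤ) (w : ℤ → ℝ) :
    recPoly n a w = ∑ i ∈ Finset.range n, w (a + i) • recPoly n a (Pi.single (a + i) 1) := by
  have h : recPoly n a w =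
      recPoly n a (∑ i ∈ Finset.range n, w (a + i) • Pi.single (a + (i : ℤ)) (1 : ℝ)) := by
    refine recPoly_congr fun i hi => ?_
    rw [Finset.sum_apply, Finset.sum_eq_single i]
    · simp
    · intro j _ hji
      have : a + (i : ℤ) ≠ a + j := by simpa using Ne.symm hji
      simp [Ne.symm hji]
    · exact fun h => absurd (Finset.mem_range.2 hi) h
  rw [h]
  simp only [← recPolyLin_apply, map_sum, map_smul]

/-- The partial sums of the data telescope to `V` at the interfaces up to a constant, which the
derivative removes; the degree bound makes the interpolation exact. -/
theorem recPoly_of_primitive {n : ℕ} (a : ℤ) {w : ℤ → ℝ} {V : ℝ[X]}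
    (hV : V.degree < ((n + 1 : ℕ) : WithBot ℕ))
    (hw : ∀ i : ℤ, w i = V.eval ((i : ℝ) + 1 / 2) - V.eval ((i : ℝ) - 1 / 2)) :
    recPoly n a w = derivative V := by
  have h : V - C (V.eval ((a : ℝ) - 1 / 2)) =
      Lagrange.interpolate (Finset.range (n + 1)) (fun j : ℕ => (a : ℝ) + j - 1 / 2)
        (fun j : ℕ => ∑ i ∈ Finset.range j, w (a + i)) := by
    refine Lagrange.eq_interpolate_of_eval_eq _ (injOn_cellNode n a) ?_ ?_
    · rw [Finset.card_range]
      refine (degree_sub_le _ _).trans_lt (max_lt hV (degree_C_le.trans_lt ?_))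
      exact_mod_cast Nat.succ_pos n
    · intro j _
      simp only [eval_sub, eval_C]
      have := Finset.sum_range_sub (fun i : ℕ => V.eval ((a : ℝ) + i - 1 / 2)) j
      rw [Nat.cast_zero, add_zero] at this
      rw [← this]
      refine Finset.sum_congr rfl fun i _ => ?_
      rw [hw]
      push_cast
      congr 2
      ring
  unfold recPoly
  rw [← h, derivative_sub, derivative_C, sub_zero]

/-- The central difference sends `X ^ (n + 1)` to a polynomial with top term `(n + 1) X ^ n`, so the
leading coefficient can be peeled off inductively; this dictates `c`. -/
theorem exists_primitive (n : ℕ) (P : ℝ[X]) (hP : P.degree < (n : WithBot ℕ)) :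
    ∃ V : ℝ[X], V.degree < ((n + 1 : ℕ) : WithBot ℕ) ∧
      V.comp (X + C (1 / 2)) - V.comp (X - C (1 / 2)) = P := by
  induction n generalizing P with
  | zero =>
    refine ⟨0, by simp, ?_⟩
    have : P = 0 := by
      rw [← degree_eq_bot, ← Nat.WithBot.lt_zero_iff]; simpa using hP
    simp [this]
  | succ n ih =>
    set c : ℝ := P.coeff n / (n + 1) with hc
    set V₀ : ℝ[X] := C c * X ^ (n + 1) with hV₀
    have hcoef : ∀ m, (V₀.comp (X + C (1 / 2)) - V₀.comp (X - C (1 / 2))).coeff m =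
        c * (((1 / 2) ^ (n + 1 - m) - (-(1 / 2)) ^ (n + 1 - m)) * ((n + 1).choose m : ℝ)) := by
      intro m
      have h2 : (X - C (1 / 2) : ℝ[X]) = X + C (-(1 / 2)) := by rw [C_neg, sub_eq_add_neg]
      rw [hV₀, h2]
      simp only [mul_comp, C_comp, pow_comp, X_comp]
      rw [coeff_sub, coeff_C_mul, coeff_C_mul, coeff_X_add_C_pow, coeff_X_add_C_pow]
      ring
    obtain ⟨V₁, hV₁, h₁⟩ := ih (P - (V₀.comp (X + C (1 / 2)) - V₀.comp (X - C (1 / 2)))) (by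
      rw [degree_lt_iff_coeff_zero]
      intro m hm
      rw [coeff_sub, hcoef]
      rcases lt_trichotomy m (n + 1) with h | h | h
      · obtain rfl : m = n := by omega
        have : (m : ℝ) + 1 ≠ 0 := by positivity
        simp only [add_tsub_cancel_left, pow_one, Nat.choose_succ_self_right, hc]
        push_cast
        field_simp
        ring
      · subst h
        simp [coeff_eq_zero_of_degree_lt hP]
      · rw [Nat.choose_eq_zero_of_lt h, coeff_eq_zero_of_degree_lt
          (hP.trans_le (by exact_mod_cast h.le))]
        simp)
    refine ⟨V₀ + V₁, ?_, ?_⟩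
    · refine (degree_add_le _ _).trans_lt (max_lt ((degree_C_mul_X_pow_le _ _).trans_lt ?_)
        (hV₁.trans ?_)) <;> exact_mod_cast Nat.lt_succ_self _
    · rw [add_comp, add_comp, add_sub_add_comm, h₁]
      ring

theorem exists_primitive_eval (n : ℕ) (P : ℝ[X]) (hP : P.degree < (n : WithBot ℕ)) :
    ∃ V : ℝ[X], V.degree < ((n + 1 : ℕ) : WithBot ℕ) ∧
      ∀ y : ℝ, P.eval y = V.eval (y + 1 / 2) - V.eval (y - 1 / 2) := by
  obtain ⟨V, hV, h⟩ := exists_primitive n P hP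
  refine ⟨V, hV, fun y => ?_⟩
  rw [← h]
  simp [eval_comp]

/-- All reconstructions from at least `n` cells agree on the values of a polynomial of degree less
than `n`. -/
theorem recPoly_eval_eq {n n' : ℕ} (hn : n ≤ n') (a a' : ℤ) (P : ℝ[X])
    (hP : P.degree < (n : WithBot ℕ)) :
    recPoly n a (fun j => P.eval (j : ℝ)) = recPoly n' a' (fun j => P.eval (j : ℝ)) := by
  obtain ⟨V, hV, h⟩ := exists_primitive_eval n P hP
  rw [recPoly_of_primitive a hV fun i => h i, recPoly_of_primitive a' (hV.trans_le ?_) fun i => h i]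
  exact_mod_cast Nat.succ_le_succ hn

theorem degree_sub_comp_X_sub_one_lt {n : ℕ} (V : ℝ[X])
    (hV : V.degree < ((n + 1 : ℕ) : WithBot ℕ)) :
    (V - V.comp (X - C 1)).degree < (n : WithBot ℕ) := by
  rcases eq_or_ne V 0 with rfl | h0
  · simp
  have hc : V.comp (X - C 1) ≠ 0 := fun h => h0 <| by
    have := congrArg (fun P : ℝ[X] => P.comp (X + C 1)) h
    simpa [comp_assoc] using this
  refine (degree_sub_lt_left ?_ h0 ?_).trans_le ?_
  · rw [degree_eq_natDegree h0, degree_eq_natDegree hc, natDegree_comp, natDegree_X_sub_C, mul_one]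
  · rw [leadingCoeff_comp (by rw [natDegree_X_sub_C]; exact one_ne_zero), leadingCoeff_X_sub_C,
      one_pow, mul_one]
  · rw [degree_eq_natDegree h0] at hV ⊢
    have : V.natDegree < n + 1 := by exact_mod_cast hV
    exact_mod_cast Nat.lt_succ_iff.1 this

/-- The difference of the reconstructions at the two interfaces of a cell. -/
theorem eval_recPoly_sub_shift (n : ℕ) (a : ℤ) (P : ℝ[X])
    (hP : P.degree < ((n + 1 : ℕ) : WithBot ℕ)) :
    (recPoly n a (fun j => P.eval (j : ℝ))).eval (1 / 2) -
      (recPoly n a (fun j => P.eval ((j - 1 : ℤ) : ℝ))).eval (1 / 2) = (derivative P).eval 0 := by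
  obtain ⟨V, hV, h⟩ := exists_primitive (n + 1) P hP
  have hev : ∀ y : ℝ, P.eval y = V.eval (y + 1 / 2) - V.eval (y - 1 / 2) := fun y => by
    rw [← h]; simp [eval_comp]
  -- The two data sets differ by data with primitive `V - V(· - 1)`. Its degree is one lower than
  -- that of `V`, which puts it within the range of exactness although `P` may have degree `n`.
  rw [← eval_sub, ← recPolyLin_apply, ← recPolyLin_apply, ← map_sub, recPolyLin_apply,
    recPoly_of_primitive (V := V - V.comp (X - C 1)) a (degree_sub_comp_X_sub_one_lt V hV)]
  · rw [← h]
    simp [derivative_comp, eval_comp]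
    norm_num
  · intro i
    simp only [Pi.sub_apply, hev, eval_sub, eval_comp, eval_X, eval_C]
    push_cast
    ring_nf

/-! ### Optimal linear weights -/

theorem prod_Icc_erase_sub (k a b : ℕ) :
    ∏ j ∈ (Finset.Icc k (k + a + b)).erase (k + a), (((k + a : ℕ) : ℝ) - j) =
      (-1) ^ b * (a.factorial * b.factorial) := by
  induction b with
  | zero =>
    have h1 : (Finset.Icc k (k + a + 0)).erase (k + a) = Finset.Ico k (k + a) := by
      ext; simp only [Finset.mem_erase, Finset.mem_Icc, Finset.mem_Ico]; omega
    rw [h1, Finset.prod_Ico_eq_prod_range, add_tsub_cancel_left]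
    have : ∀ a : ℕ, ∏ j ∈ Finset.range a, ((a : ℝ) - j) = a.factorial := by
      intro a
      induction a with
      | zero => simp
      | succ a ih =>
        rw [Finset.prod_range_succ', Nat.factorial_succ]
        push_cast
        simp only [add_sub_add_right_eq_sub, ih]
        ring
    rw [pow_zero, one_mul, Nat.factorial_zero, Nat.cast_one, mul_one, ← this a]
    refine Finset.prod_congr rfl fun j _ => ?_
    push_cast; ring
  | succ b ih =>
    have h1 : (Finset.Icc k (k + a + (b + 1))).erase (k + a) =
        insert (k + a + (b + 1)) ((Finset.Icc k (k + a + b)).erase (k + a)) := by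
      ext; simp; omega
    rw [h1, Finset.prod_insert (by simp), ih, Nat.factorial_succ]
    push_cast
    ring

theorem prod_Icc_erase_sub_eq {k N n : ℕ} (hn : n ∈ Finset.Icc k (k + N)) :
    ∏ j ∈ (Finset.Icc k (k + N)).erase n, ((n : ℝ) - j) =
      (-1) ^ (k + N + n) * (N.factorial / N.choose (n - k)) := by
  rw [Finset.mem_Icc] at hn
  obtain ⟨a, rfl⟩ := Nat.exists_eq_add_of_le hn.1
  obtain ⟨b, hb⟩ := Nat.exists_eq_add_of_le hn.2
  have hN : N = a + b := by omega
  rw [hb, prod_Icc_erase_sub, hN, add_tsub_cancel_left]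
  have h1 := Nat.add_choose_mul_factorial_mul_factorial a b
  have h2 : ((a + b).choose a : ℝ) ≠ 0 := by
    exact_mod_cast (Nat.choose_pos (Nat.le_add_right a b)).ne'
  have h3 : k + a + b + (k + a) = 2 * (k + a) + b := by ring
  rw [h3, pow_add, pow_mul, neg_one_sq, one_pow, one_mul]
  congr 1
  rw [← Nat.choose_symm_add] at h1
  rw [eq_div_iff h2, ← h1]
  push_cast; ring

/-- In the product rule only the term that differentiates the divisor vanishing at `x r` survives.
-/
theorem eval_derivative_basis {s : Finset ℕ} {x : ℕ → ℝ} {n r : ℕ} (hn : n ∈ s) (hr : r ∈ s)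
    (hnr : n ≠ r) (hx : Set.InjOn x s) :
    (derivative (Lagrange.basis s x n)).eval (x r) =
      (∏ j ∈ s.erase r, (x r - x j)) / ((x r - x n) * ∏ j ∈ s.erase n, (x n - x j)) := by
  have hne : x n - x r ≠ 0 := sub_ne_zero.2 fun h => hnr (hx hn hr h)
  have hne' : x r - x n ≠ 0 := sub_ne_zero.2 fun h => hnr (hx hn hr h.symm)
  have h1 : Lagrange.basis s x n = Lagrange.basisDivisor (x n) (x r) *
      ∏ j ∈ (s.erase n).erase r, Lagrange.basisDivisor (x n) (x j) := by
    rw [Lagrange.basis, Finset.mul_prod_erase _ (fun j => Lagrange.basisDivisor (x n) (x j)) (Finset.mem_erase.2 ⟨hnr.symm, hr⟩)]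
  have h2 : ∏ j ∈ s.erase r, (x r - x j) =
      (x r - x n) * ∏ j ∈ (s.erase n).erase r, (x r - x j) := by
    rw [Finset.erase_right_comm, Finset.mul_prod_erase _ (fun j => x r - x j) (Finset.mem_erase.2 ⟨hnr, hn⟩)]
  have h3 : ∏ j ∈ s.erase n, (x n - x j) =
      (x n - x r) * ∏ j ∈ (s.erase n).erase r, (x n - x j) := by
    rw [Finset.mul_prod_erase _ (fun j => x n - x j) (Finset.mem_erase.2 ⟨hnr.symm, hr⟩)]
  rw [h1, h2, h3, derivative_mul, eval_add, eval_mul, eval_mul, Lagrange.eval_basisDivisor_right,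
    zero_mul, add_zero, eval_prod]
  simp only [Lagrange.basisDivisor, derivative_mul, derivative_C, derivative_sub, derivative_X,
    zero_mul, zero_add, sub_zero, mul_one, eval_C, eval_mul, eval_sub, eval_X]
  rw [Finset.prod_mul_distrib, Finset.prod_inv_distrib]
  rw [mul_div_mul_left _ _ hne', div_eq_mul_inv, mul_inv]
  ring

/-- The weight of the node `n` in the derivative, at the node `r`, of the interpolant at the nodes
`k, …, k + N` of a unit grid. -/
theorem eval_derivative_basis_Icc {k N n r : ℕ} (c : ℝ) (hn : n ∈ Finset.Icc k (k + N))
    (hr : r ∈ Finset.Icc k (k + N)) (hnr : n ≠ r) :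
    (derivative (Lagrange.basis (Finset.Icc k (k + N)) (fun j : ℕ => c + j) n)).eval (c + r) =
      (-1) ^ (n + r) / ((r : ℝ) - n) * (N.choose (n - k) / N.choose (r - k)) := by
  have := eval_derivative_basis (x := fun j : ℕ => c + j) hn hr hnr
    (fun a _ b _ hab => by simpa using hab)
  rw [this]
  simp only [add_sub_add_left_eq_sub]
  rw [prod_Icc_erase_sub_eq hn, prod_Icc_erase_sub_eq hr]
  rw [Finset.mem_Icc] at hn hr
  have h1 : (N.choose (n - k) : ℝ) ≠ 0 := by
    exact_mod_cast (Nat.choose_pos (by omega)).ne'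
  have h2 : (N.choose (r - k) : ℝ) ≠ 0 := by
    exact_mod_cast (Nat.choose_pos (by omega)).ne'
  have h3 : (r : ℝ) - n ≠ 0 := sub_ne_zero.2 (by exact_mod_cast hnr.symm)
  have h4 : (N.factorial : ℝ) ≠ 0 := by positivity
  have h5 : ((-1 : ℝ)) ^ (k + N + n) ≠ 0 := by simp
  have h6 : (-1 : ℝ) ^ (k + N + r) = (-1) ^ (n + r) * (-1) ^ (k + N + n) := by
    rw [← pow_add, show n + r + (k + N + n) = 2 * n + (k + N + r) by ring, pow_add _ (2 * n), pow_mul]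
    simp
  rw [h6]
  field_simp

/-- Subtracting the constant `V r` removes the summand `n = r`, so the diagonal entry of the
differentiation matrix is never needed. -/
theorem eval_derivative_interpolate_Icc {k N r : ℕ} (c : ℝ) (hr : r ∈ Finset.Icc k (k + N))
    (V : ℕ → ℝ) :
    (derivative (Lagrange.interpolate (Finset.Icc k (k + N)) (fun j : ℕ => c + j) V)).eval (c + r) =
      ∑ n ∈ (Finset.Icc k (k + N)).erase r,
        (-1) ^ (n + r) / ((r : ℝ) - n) * (N.choose (n - k) / N.choose (r - k)) * (V n - V r) := by
  set s := Finset.Icc k (k + N)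
  set x : ℕ → ℝ := fun j : ℕ => c + j with hx
  have hinj : Set.InjOn x s := fun a _ b _ hab => by simpa [hx] using hab
  have h1 : derivative (Lagrange.interpolate s x V) =
      derivative (Lagrange.interpolate s x (fun n => V n - V r)) := by
    have h2 : Lagrange.interpolate s x (fun n => V n - V r) =
        Lagrange.interpolate s x V - C (V r) := by
      have : (fun n => V n - V r) = V - V r • (1 : ℕ → ℝ) := by funext n; simp
      rw [this, map_sub, map_smul, Lagrange.interpolate_one hinj ⟨r, hr⟩, smul_eq_C_mul, mul_one]
    rw [h2, derivative_sub, derivative_C, sub_zero]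
  rw [h1, Lagrange.interpolate_apply, derivative_sum, eval_finsetSum,
    ← Finset.add_sum_erase _ _ hr]
  simp only [sub_self, C_0, zero_mul, derivative_zero, eval_zero, zero_add]
  refine Finset.sum_congr rfl fun n hn => ?_
  rw [derivative_C_mul, eval_C_mul, eval_derivative_basis_Icc c (Finset.mem_of_mem_erase hn) hr
    (Finset.ne_of_mem_erase hn)]
  ring

/-- Interface `n` is located at `1 / 2 - r + n`, so `1 / 2` is interface `r`. All stencils share one
primitive, summed from cell `1 - r`; this makes the candidates and the full reconstruction
comparable term by term. -/
theorem eval_recPoly_half {k N r : ℕ} (hr : r ∈ Finset.Icc k (k + N)) (w : ℤ → ℝ) :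
    (recPoly N ((k : ℤ) - r + 1) w).eval (1 / 2) =
      ∑ n ∈ (Finset.Icc k (k + N)).erase r,
        (-1) ^ (n + r) / ((r : ℝ) - n) * (N.choose (n - k) / N.choose (r - k)) *
          (∑ i ∈ Finset.range n, w (1 - r + i) - ∑ i ∈ Finset.range r, w (1 - r + i)) := by
  set V : ℕ → ℝ := fun n => ∑ i ∈ Finset.range n, w (1 - r + i) with hV
  set c : ℝ := 1 / 2 - r with hc
  have hinj : Set.InjOn (fun j : ℕ => c + j) (Finset.Icc k (k + N)) :=
    fun a _ b _ hab => by simpa using hab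
  rw [← eval_derivative_interpolate_Icc c hr V]
  have hcr : c + r = 1 / 2 := by rw [hc]; ring
  rw [hcr]
  have h : Lagrange.interpolate (Finset.Icc k (k + N)) (fun j : ℕ => c + j) V - C (V k) =
      Lagrange.interpolate (Finset.range (N + 1))
        (fun j : ℕ => (((k : ℤ) - r + 1 : ℤ) : ℝ) + j - 1 / 2)
        (fun j : ℕ => ∑ i ∈ Finset.range j, w ((k : ℤ) - r + 1 + i)) := by
    refine Lagrange.eq_interpolate_of_eval_eq _ (injOn_cellNode N _) ?_ ?_
    · rw [Finset.card_range]
      refine (degree_sub_le _ _).trans_lt (max_lt ?_ (degree_C_le.trans_lt ?_))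
      · refine (Lagrange.degree_interpolate_lt V hinj).trans_le ?_
        rw [Nat.card_Icc]
        exact_mod_cast (by omega)
      · exact_mod_cast Nat.succ_pos N
    · intro j hj
      have hx : (((k : ℤ) - r + 1 : ℤ) : ℝ) + j - 1 / 2 = c + (k + j : ℕ) := by
        rw [hc]; push_cast; ring
      rw [hx, eval_sub, eval_C]
      have := Lagrange.eval_interpolate_at_node V hinj (i := k + j)
        (by rw [Finset.mem_range] at hj; rw [Finset.mem_Icc]; omega)
      rw [this, hV]
      simp only
      rw [Finset.sum_range_add, add_sub_cancel_left]
      refine Finset.sum_congr rfl fun i _ => ?_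
      congr 1
      push_cast; ring
  unfold recPoly
  rw [← h, derivative_sub, derivative_C, sub_zero]

theorem sum_choose_mul_choose (r n : ℕ) (hr : 1 ≤ r) :
    ∑ k ∈ Finset.range r, (if k ≤ n then (r - 1).choose k * r.choose (n - k) else 0) =
      (2 * r - 1).choose n := by
  have h := Nat.add_choose_eq (r - 1) r n
  rw [Finset.Nat.sum_antidiagonal_eq_sum_range_succ
    (fun i j => (r - 1).choose i * r.choose j)] at h
  rw [show 2 * r - 1 = r - 1 + r by omega, h, ← Finset.sum_filter]
  refine Finset.sum_subset (fun k hk => ?_) fun k hk hk' => ?_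
  · simp only [Finset.mem_filter, Finset.mem_range] at hk ⊢; omega
  · simp only [Finset.mem_filter, Finset.mem_range] at hk hk'
    rw [Nat.choose_eq_zero_of_lt (by omega), zero_mul]

theorem sum_wenoLinearWeight (r : ℕ) (hr : 1 ≤ r) :
    ∑ k ∈ Finset.range r, wenoLinearWeight r k = 1 := by
  unfold wenoLinearWeight
  have h0 : ((2 * r - 1).choose r : ℝ) ≠ 0 := by
    exact_mod_cast (Nat.choose_pos (by omega)).ne'
  rw [← Finset.sum_div, div_eq_one_iff_eq h0, ← sum_choose_mul_choose r r hr]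
  push_cast
  refine Finset.sum_congr rfl fun k hk => ?_
  rw [Finset.mem_range] at hk
  rw [if_pos hk.le, Nat.choose_symm hk.le, mul_comm]

theorem sum_wenoLinearWeight_mul_eval (r : ℕ) (hr : 1 ≤ r) (w : ℤ → ℝ) :
    ∑ k ∈ Finset.range r, wenoLinearWeight r k * (wenoPoly r k w).eval (1 / 2) =
      (recPoly (2 * r - 1) (1 - r) w).eval (1 / 2) := by
  set D : ℕ → ℝ := fun n => (-1) ^ (n + r) / ((r : ℝ) - n) *
    (∑ i ∈ Finset.range n, w (1 - r + i) - ∑ i ∈ Finset.range r, w (1 - r + i)) with hD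
  have h0 : ((2 * r - 1).choose r : ℝ) ≠ 0 := by
    exact_mod_cast (Nat.choose_pos (by omega)).ne'
  set B := (Finset.Icc 0 (0 + (2 * r - 1))).erase r with hB
  have hbig : (recPoly (2 * r - 1) (1 - r) w).eval (1 / 2) =
      ∑ n ∈ B, ((2 * r - 1).choose n : ℝ) / ((2 * r - 1).choose r : ℝ) * D n := by
    have := eval_recPoly_half (k := 0) (N := 2 * r - 1) (r := r)
      (by rw [Finset.mem_Icc]; omega) w
    rw [show ((0 : ℕ) : ℤ) - r + 1 = 1 - r by push_cast; ring] at this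
    rw [this]
    refine Finset.sum_congr rfl fun n _ => ?_
    rw [hD]; simp only [Nat.sub_zero]; ring
  -- The factor `r.choose k` of the optimal weight cancels the denominator `r.choose (r - k)` of the
  -- candidate; summing what remains over `k` is Vandermonde's identity.
  have hsmall : ∀ k ∈ Finset.range r, wenoLinearWeight r k * (wenoPoly r k w).eval (1 / 2) =
      ∑ n ∈ B, ((if k ≤ n then (r - 1).choose k * r.choose (n - k) else 0 : ℕ) : ℝ) /
        ((2 * r - 1).choose r : ℝ) * D n := by
    intro k hk
    rw [Finset.mem_range] at hk
    have h1 : (r.choose k : ℝ) ≠ 0 := by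
      exact_mod_cast (Nat.choose_pos hk.le).ne'
    rw [wenoPoly, eval_recPoly_half (by rw [Finset.mem_Icc]; omega), Finset.mul_sum]
    rw [← Finset.sum_subset (s₁ := (Finset.Icc k (k + r)).erase r) (s₂ := B)]
    · refine Finset.sum_congr rfl fun n hn => ?_
      simp only [Finset.mem_erase, Finset.mem_Icc] at hn
      rw [if_pos hn.2.1, wenoLinearWeight, hD, Nat.choose_symm hk.le]
      push_cast
      field_simp
    · intro n hn
      simp only [hB, Finset.mem_erase, Finset.mem_Icc] at hn ⊢
      omega
    · intro n hn hn'
      simp only [hB, Finset.mem_erase, Finset.mem_Icc] at hn hn'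
      split_ifs with h
      · rw [Nat.choose_eq_zero_of_lt (by omega : r < n - k)]; simp
      · simp
  rw [Finset.sum_congr rfl hsmall, Finset.sum_comm, hbig]
  refine Finset.sum_congr rfl fun n _ => ?_
  rw [← Finset.sum_mul, ← Finset.sum_div, ← Nat.cast_sum, sum_choose_mul_choose r n hr]

/-! ### Asymptotics of the nonlinear reconstruction -/

section WenoAsymptotics

variable {ι : Type*} {L : Filter ι}

theorem isBigO_linear_recPoly (lam : ℝ[X] →ₗ[ℝ] ℝ) (n : ℕ) (a : ℤ) {w : ι → ℤ → ℝ} {η : ι → ℝ}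
    (hw : ∀ j, (fun z => w z j) =O[L] η) :
    (fun z => lam (recPoly n a (w z))) =O[L] η := by
  have : (fun z => lam (recPoly n a (w z))) = fun z => ∑ i ∈ Finset.range n,
      lam (recPoly n a (Pi.single (a + i) 1)) * w z (a + i) := by
    funext z
    rw [recPoly_eq_sum n a (w z)]
    simp [map_sum, mul_comm]
  rw [this]
  exact IsBigO.fun_sum fun i _ => (hw _).const_mul_left _

theorem isBigO_bilinear_recPoly (B : ℝ[X] →ₗ[ℝ] ℝ[X] →ₗ[ℝ] ℝ) (n n' : ℕ) (a a' : ℤ)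
    {w w' : ι → ℤ → ℝ} {η η' : ι → ℝ}
    (hw : ∀ j, (fun z => w z j) =O[L] η) (hw' : ∀ j, (fun z => w' z j) =O[L] η') :
    (fun z => B (recPoly n a (w z)) (recPoly n' a' (w' z))) =O[L] fun z => η z * η' z := by
  have : (fun z => B (recPoly n a (w z)) (recPoly n' a' (w' z))) =
      fun z => ∑ i ∈ Finset.range n, w z (a + i) *
        B (recPoly n a (Pi.single (a + i) 1)) (recPoly n' a' (w' z)) := by
    funext z
    rw [recPoly_eq_sum n a (w z)]
    simp [map_sum, LinearMap.sum_apply]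
  rw [this]
  exact IsBigO.fun_sum fun i _ => (hw _).mul (isBigO_linear_recPoly _ _ _ hw')

/-- Integration of polynomials over the reference cell. -/
def cellIntegral : ℝ[X] →ₗ[ℝ] ℝ where
  toFun P := ∫ y in (-(1 / 2) : ℝ)..(1 / 2), P.eval y
  map_add' P Q := by
    simp only [eval_add]
    exact intervalIntegral.integral_add (P.continuous.intervalIntegrable _ _)
      (Q.continuous.intervalIntegrable _ _)
  map_smul' c P := by
    simp only [eval_smul, smul_eq_mul, RingHom.id_apply]
    exact intervalIntegral.integral_const_mul _ _

/-- The symmetric bilinear form whose quadratic form is the smoothness indicator. -/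
def indicatorForm (r : ℕ) : ℝ[X] →ₗ[ℝ] ℝ[X] →ₗ[ℝ] ℝ :=
  ∑ l ∈ Finset.Icc 1 (r - 1), ((LinearMap.mul ℝ ℝ[X]).compl₁₂
    ((derivative : ℝ[X] →ₗ[ℝ] ℝ[X]) ^ l) ((derivative : ℝ[X] →ₗ[ℝ] ℝ[X]) ^ l)).compr₂ cellIntegral

theorem indicatorForm_apply (r : ℕ) (P Q : ℝ[X]) : indicatorForm r P Q =
    ∑ l ∈ Finset.Icc 1 (r - 1), cellIntegral (derivative^[l] P * derivative^[l] Q) := by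
  simp [indicatorForm, LinearMap.sum_apply, Module.End.pow_apply]

theorem indicatorForm_comm (r : ℕ) (P Q : ℝ[X]) : indicatorForm r P Q = indicatorForm r Q P := by
  simp only [indicatorForm_apply, mul_comm]

theorem wenoIndicator_eq (r k : ℕ) (w : ℤ → ℝ) :
    wenoIndicator r k w = indicatorForm r (wenoPoly r k w) (wenoPoly r k w) := by
  rw [indicatorForm_apply]
  refine Finset.sum_congr rfl fun l _ => ?_
  change _ = ∫ y in (-(1 / 2) : ℝ)..(1 / 2), _
  simp only [eval_mul, sq]

theorem wenoIndicator_nonneg (r k : ℕ) (w : ℤ → ℝ) : 0 ≤ wenoIndicator r k w :=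
  Finset.sum_nonneg fun _ _ => intervalIntegral.integral_nonneg (by norm_num) fun _ _ => sq_nonneg _

theorem wenoLinearWeight_nonneg (r k : ℕ) : 0 ≤ wenoLinearWeight r k := by
  unfold wenoLinearWeight; positivity

theorem wenoLinearWeight_zero_pos {r : ℕ} (hr : 1 ≤ r) : 0 < wenoLinearWeight r 0 := by
  have : 0 < (2 * r - 1).choose r := Nat.choose_pos (by omega)
  unfold wenoLinearWeight
  simp only [Nat.choose_zero_right]
  positivity

theorem wenoAlpha_eq (r p : ℕ) (ε : ℝ) (k : ℕ) (w : ℤ → ℝ) :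
    wenoAlpha r p ε k w = wenoLinearWeight r k * (ε + wenoIndicator r k w)⁻¹ ^ p := by
  rw [wenoAlpha, div_eq_mul_inv, inv_pow]

theorem wenoAlpha_nonneg (r p : ℕ) {ε : ℝ} (hε : 0 < ε) (k : ℕ) (w : ℤ → ℝ) :
    0 ≤ wenoAlpha r p ε k w := by
  have := wenoIndicator_nonneg r k w
  have := wenoLinearWeight_nonneg r k
  rw [wenoAlpha]
  positivity

theorem wenoAlpha_zero_pos {r : ℕ} (hr : 1 ≤ r) (p : ℕ) {ε : ℝ} (hε : 0 < ε) (w : ℤ → ℝ) :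
    0 < wenoAlpha r p ε 0 w := by
  have := wenoIndicator_nonneg r 0 w
  have := wenoLinearWeight_zero_pos hr
  rw [wenoAlpha]
  positivity

theorem wenoAlpha_zero_le_sum {r : ℕ} (hr : 1 ≤ r) (p : ℕ) {ε : ℝ} (hε : 0 < ε) (w : ℤ → ℝ) :
    wenoAlpha r p ε 0 w ≤ ∑ j ∈ Finset.range r, wenoAlpha r p ε j w :=
  Finset.single_le_sum (f := fun j => wenoAlpha r p ε j w)
    (fun j _ => wenoAlpha_nonneg r p hε j w) (Finset.mem_range.2 hr)

theorem isBigO_pow_sub_pow {a b η : ι → ℝ} (ha : a =O[L] (1 : ι → ℝ)) (hb : b =O[L] (1 : ι → ℝ))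
    (hab : (fun z => a z - b z) =O[L] η) (p : ℕ) : (fun z => a z ^ p - b z ^ p) =O[L] η := by
  induction p with
  | zero => simpa using isBigO_zero _ _
  | succ p ih =>
    have h1 := ha.mul ih
    have h2 := hab.mul (hb.pow p)
    simp only [Pi.one_apply, one_pow, one_mul, mul_one] at h1 h2
    refine (h1.add h2).congr_left fun z => ?_
    ring

/-- For smooth data the nonlinear reconstruction from `r` candidates agrees with the linear one up
to the square of the error of the candidates. -/
theorem isBigO_wenoRec_sub {r : ℕ} (hr : 1 ≤ r) (p : ℕ) {ε : ℝ} (hε : 0 < ε) {w : ι → ℤ → ℝ}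
    {P : ι → ℝ[X]} (hP : ∀ z, (P z).degree < (r : WithBot ℕ)) {η : ι → ℝ}
    (hw : ∀ j : ℤ, (fun z => w z j - (P z).eval (j : ℝ)) =O[L] η)
    (hw1 : ∀ j : ℤ, (fun z => w z j) =O[L] (1 : ι → ℝ)) :
    (fun z => wenoRec r p ε (w z) - (recPoly (2 * r - 1) (1 - r) (w z)).eval (1 / 2))
      =O[L] fun z => η z * η z := by
  set Q : ι → ℝ[X] := fun z => recPoly (2 * r - 1) (1 - r) (w z) with hQ
  set ρ : ι → ℤ → ℝ := fun z j => w z j - (P z).eval (j : ℝ) with hρ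
  set Pd : ι → ℤ → ℝ := fun z j => (P z).eval (j : ℝ) with hPd
  have hρO : ∀ j, (fun z => ρ z j) =O[L] η := hw
  have hwρ : ∀ z, w z = ρ z + Pd z := fun z => by funext j; simp [hρ, hPd]
  have hsplit : ∀ n a z, recPoly n a (w z) = recPoly n a (ρ z) + recPoly n a (Pd z) := by
    intro n a z
    rw [hwρ]
    simp only [← recPolyLin_apply, map_add]
  -- Both reconstructions agree on the values of `P`, so their difference sees only `ρ`.
  have hq : ∀ k, (fun z => (wenoPoly r k (w z)).eval (1 / 2) - (Q z).eval (1 / 2)) =O[L] η := by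
    intro k
    have h1 := isBigO_linear_recPoly (L := L) (leval (1 / 2 : ℝ)) r ((k : ℤ) - r + 1) hρO
    have h2 := isBigO_linear_recPoly (L := L) (leval (1 / 2 : ℝ)) (2 * r - 1) (1 - r) hρO
    refine (h1.sub h2).congr_left fun z => ?_
    rw [hQ, wenoPoly]
    simp only [hsplit]
    have h3 : recPoly r ((k : ℤ) - r + 1) (Pd z) = recPoly (2 * r - 1) (1 - (r : ℤ)) (Pd z) :=
      recPoly_eval_eq (by omega) _ _ (P z) (hP z)
    rw [h3]
    simp only [leval_apply, eval_add]
    ring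
  have hβ1 : ∀ k, (fun z => wenoIndicator r k (w z)) =O[L] (1 : ι → ℝ) := by
    intro k
    have := isBigO_bilinear_recPoly (L := L) (indicatorForm r) r r ((k : ℤ) - r + 1)
      ((k : ℤ) - r + 1) hw1 hw1
    simp only [Pi.one_apply, mul_one] at this
    refine this.congr_left fun z => ?_
    rw [wenoIndicator_eq]; rfl
  -- With `B` the symmetric form, `B(x,x) - B(y,y) = B(x-y, x+y)`. The candidates coincide on the
  -- values of `P`, so `x - y` is `O(η)`, while `x + y` is bounded.
  have hβ : ∀ k j, (fun z => wenoIndicator r k (w z) - wenoIndicator r j (w z)) =O[L] η := by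
    intro k j
    have h := fun i i' => isBigO_bilinear_recPoly (L := L) (indicatorForm r) r r ((i : ℕ) - r + 1)
      ((i' : ℕ) - r + 1) hρO hw1
    simp only [Pi.one_apply, mul_one] at h
    refine (((h k k).add (h k j)).sub ((h j k).add (h j j))).congr_left fun z => ?_
    have e : wenoPoly r k (w z) - wenoPoly r j (w z) =
        wenoPoly r k (ρ z) - wenoPoly r j (ρ z) := by
      simp only [wenoPoly, hsplit]
      have h3 : recPoly r ((k : ℤ) - r + 1) (Pd z) = recPoly r ((j : ℤ) - r + 1) (Pd z) :=
        recPoly_eval_eq le_rfl _ _ (P z) (hP z)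
      rw [h3]
      ring
    have e2 : indicatorForm r (wenoPoly r k (w z)) (wenoPoly r k (w z)) -
        indicatorForm r (wenoPoly r j (w z)) (wenoPoly r j (w z)) =
        indicatorForm r (wenoPoly r k (w z) - wenoPoly r j (w z))
          (wenoPoly r k (w z) + wenoPoly r j (w z)) := by
      simp only [map_sub, map_add, LinearMap.sub_apply]
      rw [indicatorForm_comm r (wenoPoly r j (w z)) (wenoPoly r k (w z))]
      ring
    rw [wenoIndicator_eq, wenoIndicator_eq, e2, e]
    simp only [map_sub, map_add, LinearMap.sub_apply, wenoPoly]
    ring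
  have hpos : ∀ k z, ε ≤ ε + wenoIndicator r k (w z) := fun k z =>
    le_add_of_nonneg_right (wenoIndicator_nonneg r k (w z))
  have hinv : ∀ k, (fun z => (ε + wenoIndicator r k (w z))⁻¹) =O[L] (1 : ι → ℝ) := by
    intro k
    refine IsBigO.of_bound ε⁻¹ (Eventually.of_forall fun z => ?_)
    have h0 := hε.trans_le (hpos k z)
    rw [Pi.one_apply, norm_one, mul_one, Real.norm_eq_abs, abs_of_pos (inv_pos.2 h0)]
    exact inv_anti₀ hε (hpos k z)
  set N : ℕ → ι → ℝ := fun k z => (ε + wenoIndicator r k (w z))⁻¹ ^ p with hN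
  have hNdiff : ∀ k j, (fun z => N k z - N j z) =O[L] η := by
    intro k j
    refine isBigO_pow_sub_pow (hinv k) (hinv j) ?_ p
    have := ((hinv k).mul (hinv j)).mul (hβ j k)
    simp only [Pi.one_apply, one_mul] at this
    refine this.congr_left fun z => ?_
    have h1 := (hε.trans_le (hpos k z)).ne'
    have h2 := (hε.trans_le (hpos j z)).ne'
    field_simp
    ring
  set S : ι → ℝ := fun z => ∑ j ∈ Finset.range r, wenoAlpha r p ε j (w z) with hS
  have hSpos : ∀ z, 0 < S z := fun z =>
    (wenoAlpha_zero_pos hr p hε (w z)).trans_le (wenoAlpha_zero_le_sum hr p hε (w z))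
  -- The denominator is bounded below by candidate 0 alone, as its optimal weight is positive and
  -- its indicator bounded.
  have hSinv : (fun z => (S z)⁻¹) =O[L] (1 : ι → ℝ) := by
    have h1 : (fun z => (wenoLinearWeight r 0)⁻¹ * (ε + wenoIndicator r 0 (w z)) ^ p)
        =O[L] (1 : ι → ℝ) := by
      have := (((isBigO_const_const ε one_ne_zero L).add (hβ1 0)).pow p).const_mul_left
        (wenoLinearWeight r 0)⁻¹
      refine this.congr_right fun z => ?_
      simp
    refine (IsBigO.of_bound 1 (Eventually.of_forall fun z => ?_)).trans h1
    rw [one_mul, Real.norm_eq_abs, abs_of_pos (inv_pos.2 (hSpos z))]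
    refine (inv_anti₀ (wenoAlpha_zero_pos hr p hε (w z))
      (wenoAlpha_zero_le_sum hr p hε (w z))).trans ?_
    rw [wenoAlpha, inv_div, div_eq_inv_mul]
    exact le_abs_self _
  -- Since the `d_j` sum to 1, `ω_k - d_k = (d_k / S) ∑ d_j (N_k - N_j)`.
  have hω : ∀ k, (fun z => wenoWeight r p ε k (w z) - wenoLinearWeight r k) =O[L] η := by
    intro k
    have h1 : (fun z => ∑ j ∈ Finset.range r, wenoLinearWeight r j * (N k z - N j z)) =O[L] η :=
      IsBigO.fun_sum fun j _ => (hNdiff k j).const_mul_left _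
    have h2 := (hSinv.mul h1).const_mul_left (wenoLinearWeight r k)
    simp only [Pi.one_apply, one_mul] at h2
    refine h2.congr_left fun z => ?_
    have h3 : ∑ j ∈ Finset.range r, wenoLinearWeight r j * (N k z - N j z) = N k z - S z := by
      simp only [mul_sub, Finset.sum_sub_distrib, ← Finset.sum_mul, sum_wenoLinearWeight r hr,
        one_mul, hS, wenoAlpha_eq, hN]
    have h4 : wenoWeight r p ε k (w z) = wenoLinearWeight r k * N k z / S z := by
      rw [wenoWeight, wenoAlpha_eq]
    have := (hSpos z).ne'
    rw [h3, h4]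
    field_simp
  -- Both families of weights sum to 1, so the common value `Q(1/2)` can be subtracted from every
  -- candidate; this produces the product of two small factors.
  have hmain : (fun z => ∑ k ∈ Finset.range r, (wenoWeight r p ε k (w z) - wenoLinearWeight r k) *
      ((wenoPoly r k (w z)).eval (1 / 2) - (Q z).eval (1 / 2))) =O[L] fun z => η z * η z :=
    IsBigO.fun_sum fun k _ => (hω k).mul (hq k)
  refine hmain.congr_left fun z => ?_
  have h5 : ∑ k ∈ Finset.range r, wenoWeight r p ε k (w z) = 1 := by
    simp only [wenoWeight]
    rw [← Finset.sum_div, div_self (hSpos z).ne']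
  simp only [sub_mul, mul_sub, Finset.sum_sub_distrib, ← Finset.sum_mul]
  rw [h5, sum_wenoLinearWeight r hr, sum_wenoLinearWeight_mul_eval r hr, wenoRec]
  ring

/-- The difference of the reconstructions at the two interfaces of a cell, for data with an
expansion in powers of the step. -/
theorem isBigO_wenoRec_sub_shift {r : ℕ} (hr : 1 ≤ r) (p : ℕ) {ε : ℝ} (hε : 0 < ε)
    {w : ι → ℤ → ℝ} {h : ι → ℝ} (hh : h =O[L] (1 : ι → ℝ)) {b : ℕ → ι → ℝ}
    (hb : ∀ n, b n =O[L] fun z => h z ^ n)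
    (hw : ∀ j : ℤ, (fun z => w z j - ∑ n ∈ Finset.range (2 * r), b n z * (j : ℝ) ^ n)
      =O[L] fun z => h z ^ (2 * r)) :
    (fun z => wenoRec r p ε (w z) - wenoRec r p ε (fun j => w z (j - 1)) - b 1 z)
      =O[L] fun z => h z ^ (2 * r) := by
  have hpow : ∀ {m n : ℕ}, m ≤ n → (fun z => h z ^ n) =O[L] fun z => h z ^ m := by
    intro m n hmn
    obtain ⟨d, rfl⟩ := Nat.exists_eq_add_of_le hmn
    have := (isBigO_refl (fun z => h z ^ m) L).mul (hh.pow d)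
    simpa [pow_add] using this
  set T : ℕ → ι → ℝ[X] := fun N z => ∑ n ∈ Finset.range N, C (b n z) * X ^ n with hT
  have hTdeg : ∀ N z, (T N z).degree < (N : WithBot ℕ) := by
    intro N z
    rw [degree_lt_iff_coeff_zero]
    intro m hm
    simp only [hT, finsetSum_coeff, coeff_C_mul, coeff_X_pow]
    refine Finset.sum_eq_zero fun n hn => ?_
    rw [Finset.mem_range] at hn
    rw [if_neg (by omega), mul_zero]
  have hTeval : ∀ N z y, (T N z).eval y = ∑ n ∈ Finset.range N, b n z * y ^ n := by
    intro N z y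
    simp [hT, eval_finsetSum]
  -- The nonlinear correction needs the expansion only to order `r`, because its error is squared;
  -- the linear part below uses all `2 r` terms.
  have hwr : ∀ j : ℤ, (fun z => w z j - (T r z).eval (j : ℝ)) =O[L] fun z => h z ^ r := by
    intro j
    have h1 : (fun z => ∑ n ∈ Finset.range r, b (r + n) z * (j : ℝ) ^ (r + n))
        =O[L] fun z => h z ^ r :=
      IsBigO.fun_sum fun n _ => by
        have := ((hb (r + n)).trans (hpow (Nat.le_add_right r n))).const_mul_left
          ((j : ℝ) ^ (r + n))
        simpa only [mul_comm] using this
    refine (((hw j).trans (hpow (by omega))).add h1).congr_left fun z => ?_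
    rw [hTeval, two_mul, Finset.sum_range_add]
    ring
  have hw1 : ∀ j : ℤ, (fun z => w z j) =O[L] (1 : ι → ℝ) := by
    intro j
    have h0 : ∀ n, (fun z => h z ^ n) =O[L] (1 : ι → ℝ) := fun n =>
      (hpow (Nat.zero_le n)).congr_right fun z => pow_zero _
    have h1 : (fun z => ∑ n ∈ Finset.range (2 * r), b n z * (j : ℝ) ^ n) =O[L] (1 : ι → ℝ) :=
      IsBigO.fun_sum fun n _ => by
        have := ((hb n).trans (h0 n)).const_mul_left ((j : ℝ) ^ n)
        simpa only [mul_comm] using this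
    refine (((hw j).trans (h0 _)).add h1).congr_left fun z => ?_
    ring
  have hA := isBigO_wenoRec_sub hr p hε (hTdeg r) hwr hw1
  have hB := isBigO_wenoRec_sub hr p hε (w := fun z j => w z (j - 1)) (L := L)
    (P := fun z => (T r z).comp (X - C 1)) (η := fun z => h z ^ r) (fun z => ?_) (fun j => ?_)
    (fun j => hw1 (j - 1))
  · have hC1 := isBigO_linear_recPoly (L := L) (leval (1 / 2 : ℝ)) (2 * r - 1) (1 - r) hw
    have hC2 := isBigO_linear_recPoly (L := L) (leval (1 / 2 : ℝ)) (2 * r - 1) (1 - r)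
      (fun j => hw (j - 1))
    have hsq : ∀ z, h z ^ r * h z ^ r = h z ^ (2 * r) := fun z => by rw [← pow_add, two_mul]
    simp only [hsq] at hA hB
    refine ((hA.sub hB).add (hC1.sub hC2)).congr_left fun z => ?_
    have h1 := eval_recPoly_sub_shift (2 * r - 1) (1 - r) (T (2 * r) z) (by
      rw [show 2 * r - 1 + 1 = 2 * r by omega]; exact hTdeg _ z)
    have h2 : (derivative (T (2 * r) z)).eval 0 = b 1 z := by
      rw [← coeff_zero_eq_eval_zero, coeff_derivative]
      simp only [hT, finsetSum_coeff, coeff_C_mul, coeff_X_pow]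
      simp [show 1 < 2 * r by omega]
    rw [h2] at h1
    simp only [hTeval] at h1
    have e1 : (fun j : ℤ => w z j - ∑ n ∈ Finset.range (2 * r), b n z * (j : ℝ) ^ n) =
        w z - fun j : ℤ => ∑ n ∈ Finset.range (2 * r), b n z * (j : ℝ) ^ n := rfl
    have e2 : (fun j : ℤ => w z (j - 1) -
          ∑ n ∈ Finset.range (2 * r), b n z * ((j - 1 : ℤ) : ℝ) ^ n) =
        (fun j => w z (j - 1)) -
          fun j : ℤ => ∑ n ∈ Finset.range (2 * r), b n z * ((j - 1 : ℤ) : ℝ) ^ n := rfl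
    rw [e1, e2]
    simp only [← recPolyLin_apply, map_sub, leval_apply] at h1 ⊢
    linarith
  · refine lt_of_le_of_lt ?_ (hTdeg r z)
    rcases eq_or_ne (T r z) 0 with h0 | h0
    · simp [h0]
    · refine degree_le_of_natDegree_le ?_ |>.trans (degree_eq_natDegree h0).ge
      rw [natDegree_comp, natDegree_X_sub_C, mul_one]
  · refine (hwr (j - 1)).congr_left fun z => ?_
    simp [eval_comp]

end WenoAsymptotics

/-! ### Jets of compositions -/

section Jets

variable {F : Type} [NormedAddCommGroup F] [NormedSpace ℝ F]

/-- The `k`-th derivative of `f ∘ γ` as a function of the derivatives `w 0, …, w k` of `γ`. -/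
def jetComp : (k : ℕ) → {E : Type} → [NormedAddCommGroup E] → [NormedSpace ℝ E] →
    (E → F) → (ℕ → E) → F
  | 0, _, _, _, f, w => f (w 0)
  | k + 1, E, _, _, f, w =>
    jetComp k (E := E × E) (fun q => fderiv ℝ f q.1 q.2) (fun l => (w l, w (l + 1)))

/-- This is why a Taylor polynomial of degree `k` suffices for the `k`-th derivative of the flux. -/
theorem jetComp_congr (k : ℕ) {E : Type} [NormedAddCommGroup E] [NormedSpace ℝ E] (f : E → F)
    {w w' : ℕ → E} (h : ∀ l ≤ k, w l = w' l) : jetComp k f w = jetComp k f w' := by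
  induction k generalizing E with
  | zero => simp only [jetComp, h 0 le_rfl]
  | succ k ih =>
    simp only [jetComp]
    exact ih _ fun l hl => by rw [h l (by omega), h (l + 1) (by omega)]

theorem contDiff_fderiv_apply {E : Type} [NormedAddCommGroup E] [NormedSpace ℝ E] {f : E → F}
    (hf : ContDiff ℝ ∞ f) : ContDiff ℝ ∞ (fun q : E × E => fderiv ℝ f q.1 q.2) :=
  ((hf.fderiv_right (m := ∞) (by simp)).comp contDiff_fst).clm_apply contDiff_snd

theorem contDiffOn_jetComp (k : ℕ) {E : Type} [NormedAddCommGroup E] [NormedSpace ℝ E]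
    {X : Type*} [NormedAddCommGroup X] [NormedSpace ℝ X] {f : E → F} (hf : ContDiff ℝ ∞ f)
    {s : Set X} {W : ℕ → X → E} (hW : ∀ l, ContDiffOn ℝ ∞ (W l) s) :
    ContDiffOn ℝ ∞ (fun x => jetComp k f (fun l => W l x)) s := by
  induction k generalizing E with
  | zero => exact hf.comp_contDiffOn (hW 0)
  | succ k ih =>
    exact ih (contDiff_fderiv_apply hf) (W := fun l x => (W l x, W (l + 1) x))
      fun l => (hW l).prodMk (hW (l + 1))

/-- The chain rule is needed only for `k = 0`; the induction step applies the claim to the curve of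
pairs `(γ l, γ (l + 1))`. -/
theorem hasDerivWithinAt_jetComp (k : ℕ) {E : Type} [NormedAddCommGroup E] [NormedSpace ℝ E]
    {f : E → F} (hf : ContDiff ℝ ∞ f) {s : Set ℝ} {t : ℝ} {γ : ℕ → ℝ → E}
    (hγ : ∀ l, HasDerivWithinAt (γ l) (γ (l + 1) t) s t) :
    HasDerivWithinAt (fun r => jetComp k f (fun l => γ l r)) (jetComp (k + 1) f (fun l => γ l t))
      s t := by
  induction k generalizing E with
  | zero =>
    exact ((hf.differentiable (by simp)) _).hasFDerivAt.comp_hasDerivWithinAt t (hγ 0)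
  | succ k ih =>
    exact ih (contDiff_fderiv_apply hf) (γ := fun l r => (γ l r, γ (l + 1) r))
      fun l => (hγ l).prodMk (hγ (l + 1))

end Jets

/-! ### Directional derivatives within a set -/

section DirDeriv

variable {X E : Type*} [NormedAddCommGroup X] [NormedSpace ℝ X] [NormedAddCommGroup E]
  [NormedSpace ℝ E]

/-- The derivative within `S` in the direction `v`. -/
def dirDeriv (S : Set X) (v : X) (G : X → E) : X → E := fun z => fderivWithin ℝ G S z v

theorem contDiffOn_dirDeriv {S : Set X} (hS : UniqueDiffOn ℝ S) (v : X) {G : X → E}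
    (hG : ContDiffOn ℝ ∞ G S) : ContDiffOn ℝ ∞ (dirDeriv S v G) S :=
  (hG.fderivWithin hS (m := ∞) (by simp)).clm_apply contDiffOn_const

theorem contDiffOn_iterate_dirDeriv {S : Set X} (hS : UniqueDiffOn ℝ S) (v : X) {G : X → E}
    (hG : ContDiffOn ℝ ∞ G S) (l : ℕ) : ContDiffOn ℝ ∞ ((dirDeriv S v)^[l] G) S := by
  induction l with
  | zero => exact hG
  | succ l ih =>
    rw [Function.iterate_succ_apply']
    exact contDiffOn_dirDeriv hS v ih

theorem dirDeriv_congr {S : Set X} (v : X) {G G' : X → E} (h : Set.EqOn G G' S) :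
    Set.EqOn (dirDeriv S v G) (dirDeriv S v G') S := fun z hz => by
  unfold dirDeriv
  rw [fderivWithin_congr h (h hz)]

theorem dirDeriv_neg {S : Set X} (hS : UniqueDiffOn ℝ S) (v : X) (G : X → E) {z : X} (hz : z ∈ S) :
    dirDeriv S v (fun z => -G z) z = -dirDeriv S v G z := by
  unfold dirDeriv
  rw [fderivWithin_fun_neg (hS z hz)]
  rfl

/-- Second derivatives within `S` are symmetric also at boundary points that are limits of interior
points, which covers the times `0` and `T`. -/
theorem dirDeriv_comm {S : Set X} (hS : UniqueDiffOn ℝ S) (hS' : S ⊆ closure (interior S))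
    (v w : X) {G : X → E} (hG : ContDiffOn ℝ ∞ G S) {z : X} (hz : z ∈ S) :
    dirDeriv S v (dirDeriv S w G) z = dirDeriv S w (dirDeriv S v G) z := by
  have hd : DifferentiableWithinAt ℝ (fderivWithin ℝ G S) S z :=
    ((hG.fderivWithin hS (m := ∞) (by simp)).differentiableOn (by simp)) z hz
  have h : ∀ v w, dirDeriv S v (dirDeriv S w G) z =
      fderivWithin ℝ (fderivWithin ℝ G S) S z v w := by
    intro v w
    unfold dirDeriv
    rw [fderivWithin_clm_apply (hS z hz) hd (differentiableWithinAt_const w)]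
    simp
  rw [h, h]
  exact (hG z hz).isSymmSndFDerivWithinAt
    (by rw [minSmoothness_of_isRCLikeNormedField]; exact WithTop.coe_le_coe.2 le_top) hS (hS' hz) hz v w

theorem hasDerivWithinAt_dirDeriv {S : Set X} {v : X} {G : X → E}
    (hG : ContDiffOn ℝ ∞ G S) {s : Set ℝ} {c : ℝ → X} {t : ℝ} (hc : HasDerivWithinAt c v s t)
    (hcs : Set.MapsTo c s S) (ht : c t ∈ S) :
    HasDerivWithinAt (fun r => G (c r)) (dirDeriv S v G (c t)) s t :=
  ((hG.differentiableOn (by simp)) (c t) ht).hasFDerivWithinAt.comp_hasDerivWithinAt t hc hcs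

end DirDeriv

/-! ### Smooth functions on a space-time slab -/

section Slab

variable {E : Type} [NormedAddCommGroup E] [NormedSpace ℝ E] {Ω : Set ℝ} {T : ℝ}

/-- The space-time domain. -/
abbrev slab (Ω : Set ℝ) (T : ℝ) : Set (ℝ × ℝ) := Ω ×ˢ Set.Icc 0 T

theorem uniqueDiffOn_slab (hΩ : IsOpen Ω) (hT : 0 < T) : UniqueDiffOn ℝ (slab Ω T) :=
  hΩ.uniqueDiffOn.prod (uniqueDiffOn_Icc hT)

theorem slab_subset_closure_interior (hΩ : IsOpen Ω) (hT : 0 < T) :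
    slab Ω T ⊆ closure (interior (slab Ω T)) := by
  rw [slab, interior_prod_eq, hΩ.interior_eq, interior_Icc, closure_prod_eq, closure_Ioo hT.ne]
  exact Set.prod_mono subset_closure le_rfl

/-- The space derivative of a function on the slab. -/
abbrev slabDx (Ω : Set ℝ) (T : ℝ) (G : ℝ × ℝ → E) : ℝ × ℝ → E := dirDeriv (slab Ω T) (1, 0) G

/-- The time derivative of a function on the slab. -/
abbrev slabDt (Ω : Set ℝ) (T : ℝ) (G : ℝ × ℝ → E) : ℝ × ℝ → E := dirDeriv (slab Ω T) (0, 1) G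

theorem hasDerivAt_slabDx (hΩ : IsOpen Ω) {G : ℝ × ℝ → E} (hG : ContDiffOn ℝ ∞ G (slab Ω T))
    {x t : ℝ} (hx : x ∈ Ω) (ht : t ∈ Set.Icc 0 T) :
    HasDerivAt (fun y => G (y, t)) (slabDx Ω T G (x, t)) x :=
  (hasDerivWithinAt_dirDeriv hG
    ((hasDerivAt_id x).prodMk (hasDerivAt_const x t)).hasDerivWithinAt
    (fun _ hy => ⟨hy, ht⟩) (⟨hx, ht⟩ : (id x, t) ∈ slab Ω T)).hasDerivAt (hΩ.mem_nhds hx)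

theorem hasDerivWithinAt_slabDt {G : ℝ × ℝ → E} (hG : ContDiffOn ℝ ∞ G (slab Ω T))
    {x t : ℝ} (hx : x ∈ Ω) (ht : t ∈ Set.Icc 0 T) :
    HasDerivWithinAt (fun s => G (x, s)) (slabDt Ω T G (x, t)) (Set.Icc 0 T) t :=
  hasDerivWithinAt_dirDeriv hG
    ((hasDerivAt_const t x).prodMk (hasDerivAt_id t)).hasDerivWithinAt
    (fun _ hy => ⟨hx, hy⟩) (⟨hx, ht⟩ : (x, id t) ∈ slab Ω T)

theorem hasDerivAt_iterate_slabDx (hΩ : IsOpen Ω) (hT : 0 < T) {G : ℝ × ℝ → E}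
    (hG : ContDiffOn ℝ ∞ G (slab Ω T)) (l : ℕ) {x t : ℝ} (hx : x ∈ Ω) (ht : t ∈ Set.Icc 0 T) :
    HasDerivAt (fun y => (slabDx Ω T)^[l] G (y, t)) ((slabDx Ω T)^[l + 1] G (x, t)) x := by
  rw [Function.iterate_succ_apply']
  exact hasDerivAt_slabDx hΩ
    (contDiffOn_iterate_dirDeriv (uniqueDiffOn_slab hΩ hT) _ hG l) hx ht

theorem hasDerivWithinAt_iterate_slabDt (hΩ : IsOpen Ω) (hT : 0 < T) {G : ℝ × ℝ → E}
    (hG : ContDiffOn ℝ ∞ G (slab Ω T)) (l : ℕ) {x t : ℝ} (hx : x ∈ Ω) (ht : t ∈ Set.Icc 0 T) :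
    HasDerivWithinAt (fun s => (slabDt Ω T)^[l] G (x, s)) ((slabDt Ω T)^[l + 1] G (x, t))
      (Set.Icc 0 T) t := by
  rw [Function.iterate_succ_apply']
  exact hasDerivWithinAt_slabDt
    (contDiffOn_iterate_dirDeriv (uniqueDiffOn_slab hΩ hT) _ hG l) hx ht

/-- The `l`-th time derivative of `f ∘ G`. -/
def fluxJet {F : Type} [NormedAddCommGroup F] [NormedSpace ℝ F] (Ω : Set ℝ) (T : ℝ) (f : E → F)
    (G : ℝ × ℝ → E) (l : ℕ) (z : ℝ × ℝ) : F :=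
  jetComp l f (fun i => (slabDt Ω T)^[i] G z)

theorem contDiffOn_fluxJet {F : Type} [NormedAddCommGroup F] [NormedSpace ℝ F] (hΩ : IsOpen Ω)
    (hT : 0 < T) {f : E → F} (hf : ContDiff ℝ ∞ f) {G : ℝ × ℝ → E}
    (hG : ContDiffOn ℝ ∞ G (slab Ω T)) (l : ℕ) :
    ContDiffOn ℝ ∞ (fluxJet Ω T f G l) (slab Ω T) :=
  contDiffOn_jetComp l hf fun i => contDiffOn_iterate_dirDeriv (uniqueDiffOn_slab hΩ hT) _ hG i

theorem slabDt_fluxJet {F : Type} [NormedAddCommGroup F] [NormedSpace ℝ F] (hΩ : IsOpen Ω)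
    (hT : 0 < T) {f : E → F} (hf : ContDiff ℝ ∞ f) {G : ℝ × ℝ → E}
    (hG : ContDiffOn ℝ ∞ G (slab Ω T)) (l : ℕ) :
    Set.EqOn (slabDt Ω T (fluxJet Ω T f G l)) (fluxJet Ω T f G (l + 1)) (slab Ω T) := by
  rintro ⟨x, t⟩ ⟨hx, ht⟩
  have h1 := hasDerivWithinAt_slabDt (contDiffOn_fluxJet hΩ hT hf hG l) hx ht
  have h2 := hasDerivWithinAt_jetComp l hf (s := Set.Icc 0 T) (t := t)
    (γ := fun i s => (slabDt Ω T)^[i] G (x, s))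
    fun i => hasDerivWithinAt_iterate_slabDt hΩ hT hG i hx ht
  exact ((uniqueDiffOn_Icc hT) t ht).eq_deriv _ h1 h2

/-- The time derivatives of a solution of the conservation law. -/
theorem iterate_slabDt_succ_eq (hΩ : IsOpen Ω) (hT : 0 < T) {f : E → E} (hf : ContDiff ℝ ∞ f)
    {G : ℝ × ℝ → E} (hG : ContDiffOn ℝ ∞ G (slab Ω T))
    (hpde : ∀ x ∈ Ω, ∀ t ∈ Set.Icc 0 T,
      HasDerivWithinAt (fun s => G (x, s)) (-(deriv (fun y => f (G (y, t))) x)) (Set.Icc 0 T) t)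
    (l : ℕ) : Set.EqOn ((slabDt Ω T)^[l + 1] G) (fun z => -slabDx Ω T (fluxJet Ω T f G l) z)
      (slab Ω T) := by
  have hS := uniqueDiffOn_slab hΩ hT
  induction l with
  | zero =>
    rintro ⟨x, t⟩ ⟨hx, ht⟩
    have h1 := hasDerivAt_slabDx hΩ (contDiffOn_fluxJet hΩ hT hf hG 0) hx ht
    have h2 := ((uniqueDiffOn_Icc hT) t ht).eq_deriv _ (hasDerivWithinAt_slabDt hG hx ht)
      (hpde x hx t ht)
    change slabDt Ω T G (x, t) = _
    rw [h2]
    exact congrArg Neg.neg h1.deriv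
  | succ l ih =>
    intro z hz
    -- Differentiate the previous identity in time and interchange the time and space derivatives.
    rw [Function.iterate_succ_apply', slabDt, dirDeriv_congr _ ih hz, dirDeriv_neg hS _ _ hz,
      dirDeriv_comm hS (slab_subset_closure_interior hΩ hT) _ _
        (contDiffOn_fluxJet hΩ hT hf hG l) hz,
      dirDeriv_congr _ (slabDt_fluxJet hΩ hT hf hG l) hz]

end Slab

/-! ### Uniform asymptotics for small steps -/

/-- The extra factor `η` lets a small `n`-th derivative improve the order; it is of size `h` when
`g` is the difference of two curves at nearby nodes. -/
theorem isBigO_sum_smul_sub_deriv {ι E : Type*} [NormedAddCommGroup E] [NormedSpace ℝ E]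
    {L : Filter ι} {D : ι → Set ℝ} (hD : ∀ z, Convex ℝ (D z)) (n k : ℕ) (hk : k < n)
    (s : Finset ℤ) (c : ℤ → ℝ)
    (hc : ∀ l < n, ∑ j ∈ s, c j * (j : ℝ) ^ l = if l = k then (k.factorial : ℝ) else 0)
    {g : ι → ℕ → ℝ → E} {y h η : ι → ℝ} (C : ℝ) (hy : ∀ᶠ z in L, y z ∈ D z)
    (hj : ∀ᶠ z in L, ∀ j ∈ s, y z + j * h z ∈ D z)
    (hg : ∀ᶠ z in L, ∀ l < n, ∀ x ∈ D z, HasDerivWithinAt (g z l) (g z (l + 1) x) (D z) x)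
    (hb : ∀ᶠ z in L, ∀ x ∈ D z, ‖g z n x‖ ≤ C * |η z|) :
    (fun z => ∑ j ∈ s, c j • g z 0 (y z + j * h z) - h z ^ k • g z k (y z))
      =O[L] fun z => η z * h z ^ n := by
  refine IsBigO.of_bound (C * ∑ j ∈ s, |c j| * |(j : ℝ)| ^ n) ?_
  filter_upwards [hy, hj, hg, hb] with z hy hj hg hb
  refine (norm_sum_smul_sub_deriv_le (hD z) n k hk s c hc (g z) hg hb hy hj).trans_eq ?_
  rw [norm_mul, norm_pow, Real.norm_eq_abs, Real.norm_eq_abs]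
  ring

/-- The parameters are `(h, x, t, a)`. -/
def stepFilter (K : Set ℝ) (T A : ℝ) : Filter (ℝ × ℝ × ℝ × ℝ) :=
  𝓝[>] 0 ×ˢ 𝓟 (K ×ˢ Set.Icc 0 T ×ˢ Set.Icc (-A) A)

section StepFilter

variable {K : Set ℝ} {T A : ℝ}

theorem eventually_stepFilter_mem :
    ∀ᶠ z in stepFilter K T A,
      0 < z.1 ∧ z.2.1 ∈ K ∧ z.2.2.1 ∈ Set.Icc 0 T ∧ z.2.2.2 ∈ Set.Icc (-A) A := by
  unfold stepFilter
  rw [eventually_prod_principal_iff]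
  filter_upwards [self_mem_nhdsWithin] with h hh y hy
  exact ⟨hh, hy.1, hy.2.1, hy.2.2⟩

theorem tendsto_fst_stepFilter : Tendsto (fun z : ℝ × ℝ × ℝ × ℝ => z.1) (stepFilter K T A) (𝓝 0) :=
  tendsto_fst.mono_right nhdsWithin_le_nhds

theorem eventually_node_mem (c : ℝ) {r : ℝ} (hr : 0 < r) :
    ∀ᶠ z in stepFilter K T A, z.2.1 + c * z.1 ∈ Metric.closedBall z.2.1 r := by
  have h1 : Tendsto (fun z : ℝ × ℝ × ℝ × ℝ => c * z.1) (stepFilter K T A) (𝓝 0) := by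
    simpa using tendsto_fst_stepFilter.const_mul c
  filter_upwards [h1 (Metric.closedBall_mem_nhds 0 hr)] with z hz
  simpa [Metric.mem_closedBall, dist_eq_norm] using hz

theorem isBigO_step_pow {m n : ℕ} (hmn : m ≤ n) :
    (fun z : ℝ × ℝ × ℝ × ℝ => z.1 ^ n) =O[stepFilter K T A] fun z => z.1 ^ m := by
  obtain ⟨d, rfl⟩ := Nat.exists_eq_add_of_le hmn
  have h1 : (fun z : ℝ × ℝ × ℝ × ℝ => z.1) =O[stepFilter K T A] (fun _ => (1 : ℝ)) :=
    tendsto_fst_stepFilter.isBigO_one ℝ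
  have := (isBigO_refl (fun z : ℝ × ℝ × ℝ × ℝ => z.1 ^ m) (stepFilter K T A)).mul (h1.pow d)
  simpa [pow_add] using this

theorem isBigO_inv_pow_smul {E : Type*} [NormedAddCommGroup E] [NormedSpace ℝ E] {τ : ℝ}
    (k M : ℕ) {g : ℝ × ℝ × ℝ × ℝ → E}
    (hg : g =O[stepFilter K T A] fun z => z.1 ^ (k + M)) :
    (fun z => ((τ * z.1) ^ k)⁻¹ • g z) =O[stepFilter K T A] fun z => z.1 ^ M := by
  have h1 := ((isBigO_refl (fun z : ℝ × ℝ × ℝ × ℝ => (z.1 ^ k)⁻¹) (stepFilter K T A)).smul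
    hg).const_smul_left ((τ ^ k)⁻¹)
  refine h1.congr' (Eventually.of_forall fun z => ?_) ?_
  · simp only [Pi.smul_apply]
    rw [smul_smul, mul_pow, mul_inv]
  · filter_upwards [eventually_stepFilter_mem] with z hz
    have := hz.1.ne'
    rw [smul_eq_mul, pow_add]
    field_simp

end StepFilter

/-- Uniform bounds near a compact set, in space, for functions on the slab. -/
theorem exists_bound_closedBall {E : Type*} [NormedAddCommGroup E] {Ω K : Set ℝ} {T : ℝ}
    (hK : IsCompact K) {r : ℝ} (hr : Metric.cthickening r K ⊆ Ω)
    {G : ℝ × ℝ → E} (hG : ContinuousOn G (slab Ω T)) :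
    ∃ C : ℝ, ∀ x ∈ K, ∀ y ∈ Metric.closedBall x r, ∀ t ∈ Set.Icc 0 T, ‖G (y, t)‖ ≤ C := by
  obtain ⟨C, hC⟩ := ((hK.cthickening (r := r)).prod isCompact_Icc).exists_bound_of_continuousOn
    (hG.mono (Set.prod_mono hr le_rfl))
  exact ⟨C, fun x hx y hy t ht =>
    hC (y, t) ⟨Metric.closedBall_subset_cthickening hx r hy, ht⟩⟩

/-! ### Consistency of the space differences. -/

section Consistency

variable {E : Type} [NormedAddCommGroup E] [NormedSpace ℝ E] {Ω K : Set ℝ} {T : ℝ}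

theorem isBigO_spaceDiff (hΩ : IsOpen Ω) (hT : 0 < T) (hK : IsCompact K) (hKΩ : K ⊆ Ω) (A : ℝ)
    {G : ℝ × ℝ → E} (hG : ContDiffOn ℝ ∞ G (slab Ω T)) {q M : ℕ} (hq : 1 ≤ q) (hM : 1 ≤ M)
    (hMq : M ≤ 2 * q) (i : ℤ) :
    (fun z : ℝ × ℝ × ℝ × ℝ =>
      centralDiff 1 q z.1 (fun j => G (z.2.1 + ((i + j : ℤ) : ℝ) * z.1, z.2.2.1)) -
        slabDx Ω T G (z.2.1 + i * z.1, z.2.2.1)) =O[stepFilter K T A] fun z => z.1 ^ M := by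
  obtain ⟨r, hr, hrΩ⟩ := hK.exists_cthickening_subset_open hΩ hKΩ
  obtain ⟨C, hC⟩ := exists_bound_closedBall (T := T) hK hrΩ
    (contDiffOn_iterate_dirDeriv (uniqueDiffOn_slab hΩ hT) (1, 0) hG (1 + M)).continuousOn
  have h := isBigO_sum_smul_sub_deriv (L := stepFilter K T A)
    (D := fun z => Metric.closedBall z.2.1 r) (fun z => convex_closedBall _ _) (1 + M) 1 (by omega)
    (Finset.Icc (-(fdWidth 1 q : ℤ)) (fdWidth 1 q)) (fdCoeff 1 q)
    (fun l hl => sum_fdCoeff_mul_pow_of_lt le_rfl hq l (by omega))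
    (g := fun z l y => (slabDx Ω T)^[l] G (y, z.2.2.1)) (y := fun z => z.2.1 + i * z.1)
    (h := fun z => z.1) (η := fun _ => 1) C (eventually_node_mem _ hr)
    (by
      rw [eventually_all_finset]
      intro j _
      filter_upwards [eventually_node_mem (i + j : ℝ) hr] with z hz
      rwa [add_assoc, ← add_mul])
    (by
      filter_upwards [eventually_stepFilter_mem] with z hz l _ x hx
      exact (hasDerivAt_iterate_slabDx hΩ hT hG l
        (hrΩ (Metric.closedBall_subset_cthickening hz.2.1 r hx)) hz.2.2.1).hasDerivWithinAt)
    (by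
      filter_upwards [eventually_stepFilter_mem] with z hz x hx
      simpa using hC _ hz.2.1 x hx _ hz.2.2.1)
  simp only [one_mul] at h
  have h2 := isBigO_inv_pow_smul (τ := 1) 1 M h
  refine h2.congr' ?_ EventuallyEq.rfl
  filter_upwards [eventually_stepFilter_mem] with z hz
  have hz0 : z.1 ^ 1 ≠ 0 := by simpa using hz.1.ne'
  rw [one_mul, smul_sub, smul_smul, inv_mul_cancel₀ hz0, one_smul, centralDiff]
  congr 2
  refine Finset.sum_congr rfl fun j _ => ?_
  simp only [Function.iterate_zero, id]
  congr 3
  push_cast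
  ring

end Consistency

/-! ### Taylor polynomials in time -/

section TaylorCurve

variable {E : Type} [NormedAddCommGroup E] [NormedSpace ℝ E]

/-- The `l`-th derivative of the Taylor polynomial of degree `k` with derivatives `w`. -/
def taylorCurve (k : ℕ) (w : ℕ → E) (l : ℕ) (ρ : ℝ) : E :=
  ∑ i ∈ Finset.range (k + 1), (ρ ^ i / (i.factorial : ℝ)) • if l + i ≤ k then w (l + i) else 0

theorem taylorCurve_zero_right {k l : ℕ} (hl : l ≤ k) (w : ℕ → E) : taylorCurve k w l 0 = w l := by
  rw [taylorCurve, Finset.sum_range_succ']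
  simp [hl]

theorem taylorPoly_eq_taylorCurve {m : ℕ} (k : ℕ) (w : ℕ → Fin m → ℝ) (ρ : ℝ) :
    taylorPoly k w ρ = taylorCurve k w 0 ρ := by
  refine Finset.sum_congr rfl fun i hi => ?_
  rw [Finset.mem_range] at hi
  rw [zero_add, if_pos (by omega)]

theorem hasDerivAt_taylorCurve (k : ℕ) (w : ℕ → E) (l : ℕ) (ρ : ℝ) :
    HasDerivAt (taylorCurve k w l) (taylorCurve k w (l + 1) ρ) ρ := by
  have h1 : ∀ i ∈ Finset.range (k + 1), HasDerivAt
      (fun ρ : ℝ => (ρ ^ i / (i.factorial : ℝ)) • if l + i ≤ k then w (l + i) else 0)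
      (((i : ℝ) * ρ ^ (i - 1) / (i.factorial : ℝ)) • if l + i ≤ k then w (l + i) else 0) ρ :=
    fun i _ => ((hasDerivAt_pow i ρ).div_const _).smul_const _
  have h2 : HasDerivAt (taylorCurve k w l) _ ρ := HasDerivAt.fun_sum h1
  refine h2.congr_deriv (Eq.symm ?_)
  rw [taylorCurve, Finset.sum_range_succ, Finset.sum_range_succ' _ k]
  simp only [Nat.cast_zero, zero_mul, zero_div, zero_smul, add_zero]
  rw [if_neg (by omega), smul_zero, add_zero]
  refine Finset.sum_congr rfl fun i _ => ?_
  rw [show l + 1 + i = l + (i + 1) by ring]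
  congr 1
  rw [Nat.factorial_succ]
  have : (i.factorial : ℝ) ≠ 0 := by positivity
  rw [add_tsub_cancel_right]
  push_cast
  field_simp

theorem contDiffOn_taylorCurve {Ω : Set ℝ} {T : ℝ} (k l : ℕ) {W : ℕ → ℝ × ℝ → E}
    (hW : ∀ i, ContDiffOn ℝ ∞ (W i) (slab Ω T)) :
    ContDiffOn ℝ ∞ (fun q : (ℝ × ℝ) × ℝ => taylorCurve k (fun i => W i q.1) l q.2)
      (slab Ω T ×ˢ Set.univ) := by
  unfold taylorCurve
  refine ContDiffOn.sum fun i _ => ContDiffOn.smul (by fun_prop) ?_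
  split_ifs
  · exact (hW _).comp contDiffOn_fst fun q hq => hq.1
  · exact contDiffOn_const

end TaylorCurve

/-! ### Time differences of the flux along Taylor polynomials. -/

section TimeDifferences

variable {m : ℕ} {Ω K : Set ℝ} {T : ℝ}

/-- The defect of a centered difference in time of the flux along the Taylor polynomial. -/
def fluxDefect (Ω : Set ℝ) (T : ℝ) (f : (Fin m → ℝ) → (Fin m → ℝ)) (G : ℝ × ℝ → Fin m → ℝ)
    (k q : ℕ) (δ : ℝ) (y : ℝ × ℝ) : Fin m → ℝ :=
  ∑ j ∈ Finset.Icc (-(fdWidth k q : ℤ)) (fdWidth k q),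
      fdCoeff k q j • f (taylorPoly k (fun l => (slabDt Ω T)^[l] G y) (j * δ)) -
    δ ^ k • fluxJet Ω T f G k y

/-- The derivatives `H l` of the flux along the Taylor polynomial are smooth jointly in the base
point and `ρ`. Hence the `n`-th derivatives at two nodes differ by `O(h)`, which supplies the power
beyond `h ^ n`. The variable `ρ` is not confined to `[0, T]`: the Taylor polynomial is defined for
all `ρ`, and `[-1, 1]` is just a compact neighbourhood of 0. -/
theorem isBigO_fluxDefect_sub (hΩ : IsOpen Ω) (hT : 0 < T) (hK : IsCompact K) (hKΩ : K ⊆ Ω)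
    (A τ : ℝ) {f : (Fin m → ℝ) → (Fin m → ℝ)} (hf : ContDiff ℝ ∞ f) {G : ℝ × ℝ → Fin m → ℝ}
    (hG : ContDiffOn ℝ ∞ G (slab Ω T)) {k q n : ℕ} (hk : 1 ≤ k) (hq : 1 ≤ q) (hkn : k < n)
    (hn : n ≤ k + 2 * q) (i i' : ℤ) :
    (fun z : ℝ × ℝ × ℝ × ℝ => fluxDefect Ω T f G k q (τ * z.1) (z.2.1 + i * z.1, z.2.2.1) -
      fluxDefect Ω T f G k q (τ * z.1) (z.2.1 + i' * z.1, z.2.2.1))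
      =O[stepFilter K T A] fun z => z.1 ^ (n + 1) := by
  obtain ⟨r, hr, hrΩ⟩ := hK.exists_cthickening_subset_open hΩ hKΩ
  have hU := contDiffOn_iterate_dirDeriv (uniqueDiffOn_slab hΩ hT) (0, 1) hG
  set U : ℕ → ℝ × ℝ → Fin m → ℝ := fun l => (slabDt Ω T)^[l] G with hUdef
  set H : ℕ → (ℝ × ℝ) × ℝ → Fin m → ℝ := fun l q =>
    jetComp l f (fun i => taylorCurve k (fun i => U i q.1) i q.2) with hH
  set S := slab Ω T ×ˢ (Set.univ : Set ℝ) with hS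
  have hSu : UniqueDiffOn ℝ S := (uniqueDiffOn_slab hΩ hT).prod uniqueDiffOn_univ
  have hHs : ∀ l, ContDiffOn ℝ ∞ (H l) S := fun l =>
    contDiffOn_jetComp l hf fun i => contDiffOn_taylorCurve k i hU
  have hHd : ∀ l y ρ, HasDerivAt (fun ρ => H l (y, ρ)) (H (l + 1) (y, ρ)) ρ := by
    intro l y ρ
    rw [← hasDerivWithinAt_univ]
    exact hasDerivWithinAt_jetComp l hf (γ := fun i ρ => taylorCurve k (fun i => U i y) i ρ)
      fun i => (hasDerivAt_taylorCurve k _ i ρ).hasDerivWithinAt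
  obtain ⟨C, hC⟩ := (((hK.cthickening (r := r)).prod (isCompact_Icc (a := 0) (b := T))).prod
    (isCompact_Icc (a := (-1 : ℝ)) (b := 1))).exists_bound_of_continuousOn
    ((contDiffOn_dirDeriv hSu ((1, 0), 0) (hHs n)).continuousOn.mono
      (Set.prod_mono (Set.prod_mono hrΩ le_rfl) (Set.subset_univ _)))
  have hlip : ∀ x ∈ K, ∀ t ∈ Set.Icc 0 T, ∀ ρ ∈ Set.Icc (-1 : ℝ) 1,
      ∀ y ∈ Metric.closedBall x r, ∀ y' ∈ Metric.closedBall x r,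
      ‖H n ((y, t), ρ) - H n ((y', t), ρ)‖ ≤ C * |y - y'| := by
    intro x hx t ht ρ hρ y hy y' hy'
    have hsub : ∀ v ∈ Metric.closedBall x r, v ∈ Metric.cthickening r K := fun v hv =>
      Metric.closedBall_subset_cthickening hx r hv
    refine (convex_closedBall x r).norm_image_sub_le_of_norm_hasDerivWithin_le
      (f := fun y => H n ((y, t), ρ)) (f' := fun y => dirDeriv S ((1, 0), 0) (H n) ((y, t), ρ))
      (fun v hv => ?_) (fun v hv => hC _ ⟨⟨hsub v hv, ht⟩, hρ⟩) hy' hy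
    exact hasDerivWithinAt_dirDeriv (hHs n) (c := fun y => ((y, t), ρ))
      (((hasDerivAt_id v).prodMk (hasDerivAt_const v t)).prodMk
        (hasDerivAt_const v ρ)).hasDerivWithinAt
      (fun w hw => ⟨⟨hrΩ (hsub w hw), ht⟩, Set.mem_univ _⟩)
      ⟨⟨hrΩ (hsub v hv), ht⟩, Set.mem_univ _⟩
  have h := isBigO_sum_smul_sub_deriv (L := stepFilter K T A)
    (D := fun _ => Set.Icc (-1 : ℝ) 1) (fun _ => convex_Icc _ _) n k hkn
    (Finset.Icc (-(fdWidth k q : ℤ)) (fdWidth k q)) (fdCoeff k q)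
    (fun l hl => sum_fdCoeff_mul_pow_of_lt hk hq l (by omega))
    (g := fun z l ρ => H l ((z.2.1 + i * z.1, z.2.2.1), ρ) -
      H l ((z.2.1 + i' * z.1, z.2.2.1), ρ)) (y := fun _ => 0)
    (h := fun z => τ * z.1) (η := fun z => ((i : ℝ) - i') * z.1) C
    (Eventually.of_forall fun _ => by norm_num)
    (by
      rw [eventually_all_finset]
      intro j _
      have h1 : Tendsto (fun z : ℝ × ℝ × ℝ × ℝ => 0 + j * (τ * z.1)) (stepFilter K T A) (𝓝 0) := by
        simpa using (tendsto_fst_stepFilter.const_mul τ).const_mul (j : ℝ)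
      exact h1 (Icc_mem_nhds (by norm_num) (by norm_num)))
    (Eventually.of_forall fun z l _ ρ _ => ((hHd l _ ρ).sub (hHd l _ ρ)).hasDerivWithinAt)
    (by
      filter_upwards [eventually_stepFilter_mem, eventually_node_mem (i : ℝ) hr,
        eventually_node_mem (i' : ℝ) hr] with z hz hi hi' ρ hρ
      refine (hlip _ hz.2.1 _ hz.2.2.1 ρ hρ _ hi _ hi').trans_eq ?_
      congr 2
      ring)
  have h2 : (fun z : ℝ × ℝ × ℝ × ℝ => ((i : ℝ) - i') * z.1 * (τ * z.1) ^ n)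
      =O[stepFilter K T A] fun z => z.1 ^ (n + 1) := by
    refine ((isBigO_refl (fun z : ℝ × ℝ × ℝ × ℝ => z.1 ^ (n + 1)) _).const_mul_left
      (((i : ℝ) - i') * τ ^ n)).congr_left fun z => ?_
    ring
  refine (h.trans h2).congr_left fun z => ?_
  -- At `ρ = 0` the Taylor polynomial has the exact derivatives up to order `k`.
  have hk0 : ∀ y, H k (y, 0) = fluxJet Ω T f G k y := fun y =>
    jetComp_congr k f fun l hl => taylorCurve_zero_right hl _
  simp only [hk0]
  simp only [fluxDefect, smul_sub, Finset.sum_sub_distrib, taylorPoly_eq_taylorCurve, zero_add,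
    hH, jetComp, hUdef]
  abel

end TimeDifferences

/-! ### Consistency of the WENO flux difference and error propagation in the recursion. -/

section FluxConsistency

variable {m : ℕ} {Ω K : Set ℝ} {T : ℝ}

/-- The derivatives with respect to `y` of the curve `y ↦ (a, G (y, t))`. -/
def paramCurve (Ω : Set ℝ) (T : ℝ) (G : ℝ × ℝ → Fin m → ℝ) :
    ℕ → ℝ × ℝ × ℝ → ℝ × (Fin m → ℝ)
  | 0, q => (q.1, G q.2)
  | l + 1, q => (0, (slabDx Ω T)^[l + 1] G q.2)

theorem contDiffOn_paramCurve (hΩ : IsOpen Ω) (hT : 0 < T) {G : ℝ × ℝ → Fin m → ℝ}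
    (hG : ContDiffOn ℝ ∞ G (slab Ω T)) (l : ℕ) :
    ContDiffOn ℝ ∞ (paramCurve Ω T G l) (Set.univ ×ˢ slab Ω T) := by
  cases l with
  | zero => exact contDiffOn_fst.prodMk (hG.comp contDiffOn_snd fun q hq => hq.2)
  | succ l =>
    exact contDiffOn_const.prodMk ((contDiffOn_iterate_dirDeriv (uniqueDiffOn_slab hΩ hT) (1, 0)
      hG (l + 1)).comp contDiffOn_snd fun q hq => hq.2)

theorem hasDerivAt_paramCurve (hΩ : IsOpen Ω) (hT : 0 < T) {G : ℝ × ℝ → Fin m → ℝ}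
    (hG : ContDiffOn ℝ ∞ G (slab Ω T)) (l : ℕ) (a : ℝ) {y t : ℝ} (hy : y ∈ Ω)
    (ht : t ∈ Set.Icc 0 T) :
    HasDerivAt (fun y => paramCurve Ω T G l (a, y, t)) (paramCurve Ω T G (l + 1) (a, y, t)) y := by
  cases l with
  | zero => exact (hasDerivAt_const y a).prodMk (hasDerivAt_iterate_slabDx hΩ hT hG 0 hy ht)
  | succ l =>
    exact (hasDerivAt_const y (0 : ℝ)).prodMk (hasDerivAt_iterate_slabDx hΩ hT hG (l + 1) hy ht)

/-- The `l`-th space derivative of `g a (G (y, t))`. -/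
def splitJet (Ω : Set ℝ) (T : ℝ) (g : ℝ × (Fin m → ℝ) → Fin m → ℝ) (G : ℝ × ℝ → Fin m → ℝ)
    (l : ℕ) (q : ℝ × ℝ × ℝ) : Fin m → ℝ :=
  jetComp l g (fun i => paramCurve Ω T G i q)

theorem hasDerivAt_splitJet (hΩ : IsOpen Ω) (hT : 0 < T) {g : ℝ × (Fin m → ℝ) → Fin m → ℝ}
    (hg : ContDiff ℝ ∞ g) {G : ℝ × ℝ → Fin m → ℝ} (hG : ContDiffOn ℝ ∞ G (slab Ω T)) (l : ℕ)
    (a : ℝ) {y t : ℝ} (hy : y ∈ Ω) (ht : t ∈ Set.Icc 0 T) :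
    HasDerivAt (fun y => splitJet Ω T g G l (a, y, t)) (splitJet Ω T g G (l + 1) (a, y, t)) y := by
  rw [← hasDerivWithinAt_univ]
  exact hasDerivWithinAt_jetComp l hg (γ := fun i y => paramCurve Ω T G i (a, y, t))
    fun i => (hasDerivAt_paramCurve hΩ hT hG i a hy ht).hasDerivWithinAt

theorem exists_bound_splitJet (hΩ : IsOpen Ω) (hT : 0 < T) (hK : IsCompact K) {r : ℝ}
    (hr : Metric.cthickening r K ⊆ Ω) (A : ℝ) {g : ℝ × (Fin m → ℝ) → Fin m → ℝ}
    (hg : ContDiff ℝ ∞ g) {G : ℝ × ℝ → Fin m → ℝ} (hG : ContDiffOn ℝ ∞ G (slab Ω T)) (l : ℕ) :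
    ∃ C : ℝ, ∀ x ∈ K, ∀ y ∈ Metric.closedBall x r, ∀ t ∈ Set.Icc 0 T, ∀ a ∈ Set.Icc (-A) A,
      ‖splitJet Ω T g G l (a, y, t)‖ ≤ C := by
  obtain ⟨C, hC⟩ := ((isCompact_Icc (a := -A) (b := A)).prod
    ((hK.cthickening (r := r)).prod (isCompact_Icc (a := 0) (b := T)))).exists_bound_of_continuousOn
    ((contDiffOn_jetComp l hg (contDiffOn_paramCurve hΩ hT hG)).continuousOn.mono
      (Set.prod_mono (Set.subset_univ _) (Set.prod_mono hr le_rfl)))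
  exact ⟨C, fun x hx y hy t ht a ha =>
    hC (a, y, t) ⟨ha, Metric.closedBall_subset_cthickening hx r hy, ht⟩⟩

/-- The sign `σ` treats both biases at once: right-biased reconstruction is left-biased
reconstruction on the grid with step `-h`. The expansion coefficients are the Taylor coefficients of
the split flux in `x`, with `a` carried as a constant coordinate of the curve. -/
theorem isBigO_wenoRec_split (hΩ : IsOpen Ω) (hT : 0 < T) (hK : IsCompact K) (hKΩ : K ⊆ Ω)
    (A σ : ℝ) {g : ℝ × (Fin m → ℝ) → Fin m → ℝ} (hg : ContDiff ℝ ∞ g) {G : ℝ × ℝ → Fin m → ℝ}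
    (hG : ContDiffOn ℝ ∞ G (slab Ω T)) {r : ℕ} (hr : 1 ≤ r) (p : ℕ) {ε : ℝ} (hε : 0 < ε) (i : ℤ)
    (c : Fin m) {w : ℝ × ℝ × ℝ × ℝ → ℤ → ℝ}
    (hw : ∀ z j, w z j =
      g (z.2.2.2, G (z.2.1 + i * z.1 + j * (σ * z.1), z.2.2.1)) c) :
    (fun z : ℝ × ℝ × ℝ × ℝ => wenoRec r p ε (w z) - wenoRec r p ε (fun j => w z (j - 1)) -
      σ * z.1 * splitJet Ω T g G 1 (z.2.2.2, z.2.1 + i * z.1, z.2.2.1) c)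
      =O[stepFilter K T A] fun z => z.1 ^ (2 * r) := by
  obtain ⟨d, hd, hdΩ⟩ := hK.exists_cthickening_subset_open hΩ hKΩ
  have hbd := exists_bound_splitJet hΩ hT hK hdΩ A hg hG
  have hpow : (fun z : ℝ × ℝ × ℝ × ℝ => (σ * z.1) ^ (2 * r)) =O[stepFilter K T A]
      fun z => z.1 ^ (2 * r) := by
    simp only [mul_pow]
    exact (isBigO_refl _ _).const_mul_left _
  have hO1 : ∀ l, (fun z : ℝ × ℝ × ℝ × ℝ =>
      splitJet Ω T g G l (z.2.2.2, z.2.1 + i * z.1, z.2.2.1) c) =O[stepFilter K T A]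
      (fun _ => (1 : ℝ)) := by
    intro l
    obtain ⟨C, hC⟩ := hbd l
    refine IsBigO.of_bound C ?_
    filter_upwards [eventually_stepFilter_mem, eventually_node_mem (i : ℝ) hd] with z hz hi
    rw [norm_one, mul_one]
    exact (norm_le_pi_norm _ c).trans (hC _ hz.2.1 _ hi _ hz.2.2.1 _ hz.2.2.2)
  have h := isBigO_wenoRec_sub_shift (L := stepFilter K T A) hr p hε (w := w)
    (h := fun z => σ * z.1)
    (b := fun n z => (σ * z.1) ^ n / (n.factorial : ℝ) *
      splitJet Ω T g G n (z.2.2.2, z.2.1 + i * z.1, z.2.2.1) c)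
    ((tendsto_fst_stepFilter.isBigO_one ℝ).const_mul_left σ) (fun n => ?_) (fun j => ?_)
  · refine (h.trans hpow).congr_left fun z => ?_
    simp
  · refine (((isBigO_refl (fun z : ℝ × ℝ × ℝ × ℝ => (σ * z.1) ^ n) _).mul
      (hO1 n)).const_mul_left ((n.factorial : ℝ)⁻¹)).congr (fun z => ?_) fun z => mul_one _
    ring
  · obtain ⟨C, hC⟩ := hbd (2 * r)
    refine IsBigO.of_bound (C * |(j : ℝ)| ^ (2 * r)) ?_
    filter_upwards [eventually_stepFilter_mem, eventually_node_mem (i : ℝ) hd,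
      eventually_node_mem (i + j * σ : ℝ) hd] with z hz hi hij
    have hsub : ∀ v ∈ Metric.closedBall z.2.1 d, v ∈ Ω := fun v hv =>
      hdΩ (Metric.closedBall_subset_cthickening hz.2.1 d hv)
    have hnode : z.2.1 + i * z.1 + j * (σ * z.1) ∈ Metric.closedBall z.2.1 d := by
      rw [show z.2.1 + i * z.1 + j * (σ * z.1) = z.2.1 + (i + j * σ) * z.1 by ring]
      exact hij
    have h1 := norm_sub_taylor_le (convex_closedBall z.2.1 d) (C := C) (2 * r)
      (fun l y => splitJet Ω T g G l (z.2.2.2, y, z.2.2.1))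
      (fun l _ y hy => (hasDerivAt_splitJet hΩ hT hg hG l z.2.2.2 (hsub y hy)
        hz.2.2.1).hasDerivWithinAt)
      (fun y hy => hC _ hz.2.1 y hy _ hz.2.2.1 _ hz.2.2.2) hi hnode
    have h2 := (norm_le_pi_norm _ c).trans h1
    rw [add_sub_cancel_left] at h2
    rw [hw]
    simp only [Pi.sub_apply, Finset.sum_apply, Pi.smul_apply, smul_eq_mul] at h2
    refine (le_of_eq ?_).trans (h2.trans_eq ?_)
    · congr 2
      refine Finset.sum_congr rfl fun n _ => ?_
      ring
    · rw [abs_mul, mul_pow, norm_pow, Real.norm_eq_abs]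
      ring

theorem isBigO_wenoFlux_sub (hΩ : IsOpen Ω) (hT : 0 < T) (hK : IsCompact K) (hKΩ : K ⊆ Ω) (A : ℝ)
    {f : (Fin m → ℝ) → (Fin m → ℝ)} (hf : ContDiff ℝ ∞ f) {fp fm : ℝ → (Fin m → ℝ) → (Fin m → ℝ)}
    (hfp : ContDiff ℝ ∞ (fun z : ℝ × (Fin m → ℝ) => fp z.1 z.2))
    (hfm : ContDiff ℝ ∞ (fun z : ℝ × (Fin m → ℝ) => fm z.1 z.2))
    (hsplit : ∀ a w, fp a w + fm a w = f w) {G : ℝ × ℝ → Fin m → ℝ}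
    (hG : ContDiffOn ℝ ∞ G (slab Ω T)) {r : ℕ} (hr : 1 ≤ r) (p : ℕ) {ε : ℝ} (hε : 0 < ε) (i : ℤ) :
    (fun z : ℝ × ℝ × ℝ × ℝ =>
      wenoFlux r p ε (fp z.2.2.2) (fm z.2.2.2) (fun j => G (z.2.1 + j * z.1, z.2.2.1)) i -
        wenoFlux r p ε (fp z.2.2.2) (fm z.2.2.2) (fun j => G (z.2.1 + j * z.1, z.2.2.1)) (i - 1) -
      z.1 • slabDx Ω T (fluxJet Ω T f G 0) (z.2.1 + i * z.1, z.2.2.1))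
      =O[stepFilter K T A] fun z => z.1 ^ (2 * r) := by
  obtain ⟨d, hd, hdΩ⟩ := hK.exists_cthickening_subset_open hΩ hKΩ
  refine isBigO_pi.2 fun c => ?_
  have hp := isBigO_wenoRec_split hΩ hT hK hKΩ A 1 hfp hG hr p hε i c
    (w := fun z j => fp z.2.2.2 (G (z.2.1 + ((i + j : ℤ) : ℝ) * z.1, z.2.2.1)) c)
    (fun z j => by
      rw [show z.2.1 + ((i + j : ℤ) : ℝ) * z.1 = z.2.1 + i * z.1 + j * (1 * z.1) by
        push_cast; ring])
  have hm := isBigO_wenoRec_split hΩ hT hK hKΩ A (-1) hfm hG hr p hε i c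
    (w := fun z j => fm z.2.2.2 (G (z.2.1 + ((i - j : ℤ) : ℝ) * z.1, z.2.2.1)) c)
    (fun z j => by
      rw [show z.2.1 + ((i - j : ℤ) : ℝ) * z.1 = z.2.1 + i * z.1 + j * (-1 * z.1) by
        push_cast; ring])
  -- On the mirrored grid the left and right interfaces of the cell are exchanged, hence the minus
  -- sign.
  refine (hp.sub hm).congr' ?_ EventuallyEq.rfl
  filter_upwards [eventually_stepFilter_mem, eventually_node_mem (i : ℝ) hd] with z hz hi
  have hy := hdΩ (Metric.closedBall_subset_cthickening hz.2.1 d hi)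
  have e : splitJet Ω T (fun z : ℝ × (Fin m → ℝ) => fp z.1 z.2) G 1
        (z.2.2.2, z.2.1 + i * z.1, z.2.2.1) +
      splitJet Ω T (fun z : ℝ × (Fin m → ℝ) => fm z.1 z.2) G 1
        (z.2.2.2, z.2.1 + i * z.1, z.2.2.1) =
      slabDx Ω T (fluxJet Ω T f G 0) (z.2.1 + i * z.1, z.2.2.1) := by
    have h1 := (hasDerivAt_splitJet hΩ hT hfp hG 0 z.2.2.2 hy hz.2.2.1).add
      (hasDerivAt_splitJet hΩ hT hfm hG 0 z.2.2.2 hy hz.2.2.1)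
    have h2 := hasDerivAt_slabDx hΩ (contDiffOn_fluxJet hΩ hT hf hG 0) hy hz.2.2.1
    refine h1.unique (h2.congr_of_eventuallyEq (Eventually.of_forall fun y => ?_))
    exact hsplit _ _
  rw [← e]
  simp only [wenoFlux, Pi.sub_apply, Pi.smul_apply, Pi.add_apply, smul_eq_mul]
  have e1 : ∀ j : ℤ, i - 1 + j = i + (j - 1) := fun j => by ring
  have e2 : ∀ j : ℤ, i + 1 - j = i - (j - 1) := fun j => by ring
  have e3 : ∀ j : ℤ, i - 1 + 1 - j = i - j := fun j => by ring
  simp only [e3]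
  simp only [e1, e2]
  ring

/-- Eventually both arguments lie in the ball of radius `C + 1`, on which `f` is Lipschitz. -/
theorem isBigO_comp_sub {ι E : Type*} [NormedAddCommGroup E] [NormedSpace ℝ E] [ProperSpace E]
    {L : Filter ι} {f : E → E} (hf : ContDiff ℝ ∞ f) {a b : ι → E} {η : ι → ℝ}
    (hab : (fun z => a z - b z) =O[L] η) (hη : Tendsto η L (𝓝 0))
    (hb : b =O[L] (fun _ => (1 : ℝ))) : (fun z => f (a z) - f (b z)) =O[L] η := by
  obtain ⟨C, hC⟩ := hb.bound
  obtain ⟨M, hM⟩ := hf.contDiffOn.exists_lipschitzOnWith (by simp)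
    (convex_closedBall (0 : E) (C + 1)) (isCompact_closedBall _ _)
  refine IsBigO.trans (IsBigO.of_bound M ?_) hab
  filter_upwards [hC, (hab.trans_tendsto hη) (Metric.closedBall_mem_nhds 0 one_pos)] with z h1 h2
  rw [norm_one, mul_one] at h1
  have h2' : ‖a z - b z‖ ≤ 1 := by simpa using h2
  refine hM.norm_sub_le ?_ ?_
  · rw [mem_closedBall_zero_iff]
    calc ‖a z‖ = ‖b z + (a z - b z)‖ := by rw [add_sub_cancel]
      _ ≤ C + 1 := (norm_add_le _ _).trans (add_le_add h1 h2')
  · rw [mem_closedBall_zero_iff]; linarith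

/-- The `l`-th coefficient error `h ^ (R + 1 - l)` meets the factor `ρ ^ l = O(h ^ l)`, so every
term contributes the same order. -/
theorem isBigO_flux_taylorPoly_sub (A τ c : ℝ) {f : (Fin m → ℝ) → (Fin m → ℝ)}
    (hf : ContDiff ℝ ∞ f) {R k : ℕ} (hk : k ≤ R) {a b : ℝ × ℝ × ℝ × ℝ → ℕ → Fin m → ℝ}
    (hab : ∀ l ≤ k, (fun z => a z l - b z l) =O[stepFilter K T A] fun z => z.1 ^ (R + 1 - l))
    (hb : ∀ l, (fun z => b z l) =O[stepFilter K T A] (fun _ => (1 : ℝ))) :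
    (fun z => f (taylorPoly k (a z) (c * (τ * z.1))) - f (taylorPoly k (b z) (c * (τ * z.1))))
      =O[stepFilter K T A] fun z => z.1 ^ (R + 1) := by
  have hρ : ∀ l, (fun z : ℝ × ℝ × ℝ × ℝ => (c * (τ * z.1)) ^ l / (l.factorial : ℝ))
      =O[stepFilter K T A] fun z => z.1 ^ l := by
    intro l
    refine ((isBigO_refl (fun z : ℝ × ℝ × ℝ × ℝ => z.1 ^ l) _).const_mul_left
      ((c * τ) ^ l / (l.factorial : ℝ))).congr_left fun z => ?_
    ring
  refine isBigO_comp_sub hf ?_ ?_ ?_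
  · have : (fun z => ∑ l ∈ Finset.range (k + 1),
        ((c * (τ * z.1)) ^ l / (l.factorial : ℝ)) • (a z l - b z l))
        =O[stepFilter K T A] fun z => z.1 ^ (R + 1) := by
      refine IsBigO.fun_sum fun l hl => ?_
      have hl' : l ≤ k := Nat.lt_succ_iff.1 (Finset.mem_range.1 hl)
      refine ((hρ l).smul (hab l hl')).congr_right fun z => ?_
      rw [smul_eq_mul, ← pow_add, show l + (R + 1 - l) = R + 1 by omega]
    refine this.congr_left fun z => ?_
    simp only [taylorPoly, smul_sub, Finset.sum_sub_distrib]
  · have := tendsto_fst_stepFilter (K := K) (T := T) (A := A) |>.pow (R + 1)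
    simpa using this
  · refine IsBigO.fun_sum fun l _ => ?_
    have h0 := ((hρ l).trans (isBigO_step_pow (Nat.zero_le l))).smul (hb l)
    simpa using h0

theorem isBigO_iterate_slabDt_one (hΩ : IsOpen Ω) (hT : 0 < T) (hK : IsCompact K) (hKΩ : K ⊆ Ω)
    (A : ℝ) {G : ℝ × ℝ → Fin m → ℝ} (hG : ContDiffOn ℝ ∞ G (slab Ω T)) (l : ℕ) (i : ℤ) :
    (fun z : ℝ × ℝ × ℝ × ℝ => (slabDt Ω T)^[l] G (z.2.1 + i * z.1, z.2.2.1))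
      =O[stepFilter K T A] (fun _ => (1 : ℝ)) := by
  obtain ⟨d, hd, hdΩ⟩ := hK.exists_cthickening_subset_open hΩ hKΩ
  obtain ⟨C, hC⟩ := exists_bound_closedBall (T := T) hK hdΩ
    (contDiffOn_iterate_dirDeriv (uniqueDiffOn_slab hΩ hT) (0, 1) hG l).continuousOn
  refine IsBigO.of_bound C ?_
  filter_upwards [eventually_stepFilter_mem, eventually_node_mem (i : ℝ) hd] with z hz hi
  rw [norm_one, mul_one]
  exact hC _ hz.2.1 _ hi _ hz.2.2.1

/-- One step of the recursion loses one order of accuracy. -/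
theorem isBigO_recursion (hΩ : IsOpen Ω) (hT : 0 < T) (hK : IsCompact K) (hKΩ : K ⊆ Ω)
    (A : ℝ) {τ : ℝ} (hτ : 0 < τ) {f : (Fin m → ℝ) → (Fin m → ℝ)} (hf : ContDiff ℝ ∞ f)
    {G : ℝ × ℝ → Fin m → ℝ} (hG : ContDiffOn ℝ ∞ G (slab Ω T)) {R k : ℕ} (hk : 1 ≤ k) (hkR : k < R)
    {a : ℝ × ℝ × ℝ × ℝ → ℕ → ℤ → Fin m → ℝ}
    (ha : ∀ l ≤ k, ∀ i : ℤ, (fun z => a z l i - (slabDt Ω T)^[l] G (z.2.1 + i * z.1, z.2.2.1))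
      =O[stepFilter K T A] fun z => z.1 ^ (R + 1 - l)) (i : ℤ) :
    (fun z => centralDiff 1 ((R - k) ⌈/⌉ 2) z.1 (fun j : ℤ =>
        approxFluxDeriv R f (τ * z.1) k (fun l => a z l (i + j))) -
      slabDx Ω T (fluxJet Ω T f G k) (z.2.1 + i * z.1, z.2.2.1))
      =O[stepFilter K T A] fun z => z.1 ^ (R - k) := by
  set q := (R - k) ⌈/⌉ 2 with hq
  have hq' : q = (R - k + 1) / 2 := by rw [hq, Nat.ceilDiv_eq_add_pred_div]; rfl
  have hq1 : 1 ≤ q := by omega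
  have hqR : R - k ≤ 2 * q := by omega
  set s := Finset.Icc (-(fdWidth k q : ℤ)) (fdWidth k q) with hs
  set X : ℤ → ℝ × ℝ × ℝ × ℝ → Fin m → ℝ := fun l z => ∑ j ∈ s, fdCoeff k q j •
    (f (taylorPoly k (fun n => a z n (i + l)) (j * (τ * z.1))) -
      f (taylorPoly k (fun n => (slabDt Ω T)^[n] G (z.2.1 + ((i + l : ℤ) : ℝ) * z.1, z.2.2.1))
        (j * (τ * z.1)))) with hX
  have hXO : ∀ l, X l =O[stepFilter K T A] fun z => z.1 ^ (R + 1) := fun l =>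
    IsBigO.fun_sum fun j _ => (isBigO_flux_taylorPoly_sub A τ j hf hkR.le
      (fun n hn => ha n hn (i + l))
      fun n => isBigO_iterate_slabDt_one hΩ hT hK hKΩ A hG n (i + l)).const_smul_left (fdCoeff k q j)
  set D : ℤ → ℝ × ℝ × ℝ × ℝ → Fin m → ℝ := fun l z =>
    fluxDefect Ω T f G k q (τ * z.1) (z.2.1 + l * z.1, z.2.2.1) with hD
  have hDO : ∀ l, (fun z => D (i + l) z - D i z) =O[stepFilter K T A] fun z => z.1 ^ (R + 1) :=
    fun l => isBigO_fluxDefect_sub hΩ hT hK hKΩ A τ hf hG hk hq1 hkR (by omega) (i + l) i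
  have hY : (fun z => ∑ l ∈ Finset.Icc (-(fdWidth 1 q : ℤ)) (fdWidth 1 q),
      fdCoeff 1 q l • (X l z + (D (i + l) z - D i z)))
      =O[stepFilter K T A] fun z => z.1 ^ (R + 1) :=
    IsBigO.fun_sum fun l _ => ((hXO l).add (hDO l)).const_smul_left (fdCoeff 1 q l)
  -- The exponent is split into `k` powers for the time difference, one for the space difference,
  -- and the remaining order.
  rw [show R + 1 = k + (1 + (R - k)) by omega] at hY
  have hY2 := isBigO_inv_pow_smul (τ := 1) 1 (R - k) (isBigO_inv_pow_smul (τ := τ) k _ hY)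
  have hJ := isBigO_spaceDiff hΩ hT hK hKΩ A (contDiffOn_fluxJet hΩ hT hf hG k) hq1
    (by omega : 1 ≤ R - k) hqR i
  refine (hY2.add hJ).congr' ?_ EventuallyEq.rfl
  filter_upwards [eventually_stepFilter_mem] with z hz
  have hδ : (τ * z.1) ^ k ≠ 0 := pow_ne_zero _ (mul_pos hτ hz.1).ne'
  -- The space difference annihilates constants, so `D i z`, which alone may be too large, can be
  -- subtracted at every node.
  have hsum : ∑ l ∈ Finset.Icc (-(fdWidth 1 q : ℤ)) (fdWidth 1 q), fdCoeff 1 q l = 0 := by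
    simpa using sum_fdCoeff_mul_pow 1 q 0 (Nat.zero_le _)
  have hflux : ∀ l : ℤ, approxFluxDeriv R f (τ * z.1) k (fun n => a z n (i + l)) =
      ((τ * z.1) ^ k)⁻¹ • (X l z + (D (i + l) z - D i z)) + ((τ * z.1) ^ k)⁻¹ • D i z +
        fluxJet Ω T f G k (z.2.1 + ((i + l : ℤ) : ℝ) * z.1, z.2.2.1) := by
    intro l
    have h1 : fluxJet Ω T f G k (z.2.1 + ((i + l : ℤ) : ℝ) * z.1, z.2.2.1) =
        ((τ * z.1) ^ k)⁻¹ • ((τ * z.1) ^ k •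
          fluxJet Ω T f G k (z.2.1 + ((i + l : ℤ) : ℝ) * z.1, z.2.2.1)) := by
      rw [smul_smul, inv_mul_cancel₀ hδ, one_smul]
    rw [h1, ← smul_add, ← smul_add, approxFluxDeriv, centralDiff]
    congr 1
    simp only [hX, hD, fluxDefect, smul_sub, Finset.sum_sub_distrib]
    abel
  rw [one_mul, pow_one, add_sub_assoc', sub_left_inj]
  simp only [centralDiff, pow_one, hflux]
  rw [← smul_add]
  congr 1
  simp only [smul_add, Finset.sum_add_distrib, ← Finset.sum_smul, hsum, zero_smul, add_zero,
    Finset.smul_sum]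
  congr 2 <;> exact Finset.sum_congr rfl fun l _ => smul_comm _ _ _

/-- The accuracy of the approximate time derivatives. -/
theorem isBigO_approxDeriv_sub (hΩ : IsOpen Ω) (hT : 0 < T) (hK : IsCompact K) (hKΩ : K ⊆ Ω)
    (A : ℝ) {τ : ℝ} (hτ : 0 < τ) {f : (Fin m → ℝ) → (Fin m → ℝ)} (hf : ContDiff ℝ ∞ f)
    {fp fm : ℝ → (Fin m → ℝ) → (Fin m → ℝ)}
    (hfp : ContDiff ℝ ∞ (fun z : ℝ × (Fin m → ℝ) => fp z.1 z.2))
    (hfm : ContDiff ℝ ∞ (fun z : ℝ × (Fin m → ℝ) => fm z.1 z.2))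
    (hsplit : ∀ a w, fp a w + fm a w = f w) {G : ℝ × ℝ → Fin m → ℝ}
    (hG : ContDiffOn ℝ ∞ G (slab Ω T))
    (hpde : ∀ x ∈ Ω, ∀ t ∈ Set.Icc 0 T,
      HasDerivWithinAt (fun s => G (x, s)) (-(deriv (fun y => f (G (y, t))) x)) (Set.Icc 0 T) t)
    (R p : ℕ) {ε : ℝ} (hε : 0 < ε) (l : ℕ) (hl : l ≤ R) (i : ℤ) :
    (fun z : ℝ × ℝ × ℝ × ℝ => approxDeriv R p ε f (fp z.2.2.2) (fm z.2.2.2) z.1 (τ * z.1)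
        (fun j => G (z.2.1 + j * z.1, z.2.2.1)) l i -
      (slabDt Ω T)^[l] G (z.2.1 + i * z.1, z.2.2.1))
      =O[stepFilter K T A] fun z => z.1 ^ (R + 1 - l) := by
  obtain ⟨d, hd, hdΩ⟩ := hK.exists_cthickening_subset_open hΩ hKΩ
  have hdt : ∀ n, ∀ᶠ z in stepFilter K T A,
      (slabDt Ω T)^[n + 1] G (z.2.1 + i * z.1, z.2.2.1) =
        -slabDx Ω T (fluxJet Ω T f G n) (z.2.1 + i * z.1, z.2.2.1) := by
    intro n
    filter_upwards [eventually_stepFilter_mem, eventually_node_mem (i : ℝ) hd] with z hz hi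
    exact iterate_slabDt_succ_eq hΩ hT hf hG hpde n
      ⟨hdΩ (Metric.closedBall_subset_cthickening hz.2.1 d hi), hz.2.2.1⟩
  -- The node varies in the induction because the space difference uses neighbouring nodes.
  induction l using Nat.strong_induction_on generalizing i with
  | _ l ih =>
    match l, ih, hl with
    | 0, _, _ =>
      simp only [approxDeriv, Function.iterate_zero, id, sub_self]
      exact isBigO_zero _ _
    | 1, _, _ =>
      set r := (R + 1) ⌈/⌉ 2 with hr
      have hr' : r = (R + 1 + 1) / 2 := by rw [hr, Nat.ceilDiv_eq_add_pred_div]; rfl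
      -- The choice of `r` gives `2 r ≥ R + 1`, just enough to divide by `h` and keep order `R`.
      have h := (isBigO_wenoFlux_sub hΩ hT hK hKΩ A hf hfp hfm hsplit hG (r := r) (by omega) p hε
        i).trans (isBigO_step_pow (by omega : 1 + R ≤ 2 * r))
      refine (isBigO_inv_pow_smul (τ := 1) 1 R h).neg_left.congr' ?_
        (Eventually.of_forall fun z => by simp)
      filter_upwards [eventually_stepFilter_mem, hdt 0] with z hz hz'
      rw [hz', approxDeriv, smul_sub _ _ (z.1 • _), smul_smul, one_mul, pow_one,
        inv_mul_cancel₀ hz.1.ne', one_smul, neg_sub, sub_neg_eq_add, neg_add_eq_sub]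
    | k + 2, ih, hl =>
      have h := isBigO_recursion hΩ hT hK hKΩ A hτ hf hG (R := R) (k := k + 1) (by omega)
        (by omega) (a := fun z => approxDeriv R p ε f (fp z.2.2.2) (fm z.2.2.2) z.1 (τ * z.1)
          (fun j => G (z.2.1 + j * z.1, z.2.2.1)))
        (fun n hn i' => by
          refine ih n (by omega) (by omega) i' fun n' => ?_
          filter_upwards [eventually_stepFilter_mem, eventually_node_mem (i' : ℝ) hd] with z hz hi
          exact iterate_slabDt_succ_eq hΩ hT hf hG hpde n'
            ⟨hdΩ (Metric.closedBall_subset_cthickening hz.2.1 d hi), hz.2.2.1⟩) i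
      refine h.neg_left.congr' ?_ (Eventually.of_forall fun z => ?_)
      · filter_upwards [hdt (k + 1)] with z hz
        rw [hz, approxDeriv_add_two, neg_sub, sub_neg_eq_add, neg_add_eq_sub]
      · rw [show R + 1 - (k + 2) = R - (k + 1) by omega]

end FluxConsistency

/-! ### The local truncation error. -/

theorem proposition1 {m : ℕ} (R : ℕ) (hR : 1 ≤ R)
    (p : ℕ) (ε : ℝ) (hε : 0 < ε) (τ : ℝ) (hτ : 0 < τ)
    (f : (Fin m → ℝ) → (Fin m → ℝ)) (hf : ContDiff ℝ ∞ f)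
    (fp fm : ℝ → (Fin m → ℝ) → (Fin m → ℝ))
    (hfp : ContDiff ℝ ∞ (fun z : ℝ × (Fin m → ℝ) => fp z.1 z.2))
    (hfm : ContDiff ℝ ∞ (fun z : ℝ × (Fin m → ℝ) => fm z.1 z.2))
    (hsplit : ∀ a w, fp a w + fm a w = f w)
    (Ω : Set ℝ) (hΩ : IsOpen Ω) (T : ℝ) (hT : 0 < T)
    (u : ℝ → ℝ → (Fin m → ℝ))
    (hu : ContDiffOn ℝ ∞ (fun z : ℝ × ℝ => u z.1 z.2) (Ω ×ˢ Set.Icc 0 T))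
    (hpde : ∀ x ∈ Ω, ∀ t ∈ Set.Icc 0 T,
      HasDerivWithinAt (fun s => u x s) (-(deriv (fun y => f (u y t)) x)) (Set.Icc 0 T) t)
    (K : Set ℝ) (hK : IsCompact K) (hKΩ : K ⊆ Ω) (A : ℝ) :
    ∃ C h₀ : ℝ, 0 < h₀ ∧ ∀ h : ℝ, 0 < h → h < h₀ → ∀ a : ℝ, |a| ≤ A →
      ∀ x ∈ K, ∀ t : ℝ, 0 ≤ t → t + τ * h ≤ T →
        ‖u x (t + τ * h) -
            lwStep R p ε f (fp a) (fm a) h (τ * h) (fun j : ℤ => u (x + j * h) t) 0‖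
          ≤ C * h ^ (R + 1) := by
  set G : ℝ × ℝ → Fin m → ℝ := fun z => u z.1 z.2 with hG
  have hderiv : (fun z : ℝ × ℝ × ℝ × ℝ => ∑ l ∈ Finset.Icc 1 R,
      ((τ * z.1) ^ l / (l.factorial : ℝ)) •
        (approxDeriv R p ε f (fp z.2.2.2) (fm z.2.2.2) z.1 (τ * z.1)
            (fun j => G (z.2.1 + j * z.1, z.2.2.1)) l 0 -
          (slabDt Ω T)^[l] G (z.2.1 + (0 : ℤ) * z.1, z.2.2.1)))
      =O[stepFilter K T A] fun z => z.1 ^ (R + 1) := by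
    refine IsBigO.fun_sum fun l hl => ?_
    rw [Finset.mem_Icc] at hl
    have h1 : (fun z : ℝ × ℝ × ℝ × ℝ => (τ * z.1) ^ l / (l.factorial : ℝ))
        =O[stepFilter K T A] fun z => z.1 ^ l := by
      refine ((isBigO_refl (fun z : ℝ × ℝ × ℝ × ℝ => z.1 ^ l) _).const_mul_left
        (τ ^ l / (l.factorial : ℝ))).congr_left fun z => ?_
      ring
    refine (h1.smul (isBigO_approxDeriv_sub hΩ hT hK hKΩ A hτ hf hfp hfm hsplit hu hpde R p hε l
      hl.2 0)).congr_right fun z => ?_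
    rw [smul_eq_mul, ← pow_add, show l + (R + 1 - l) = R + 1 by omega]
  obtain ⟨C₁, hC₁⟩ := hderiv.bound
  -- The principal factor of the filter yields a single `h₀` for all `x`, `t` and `a`.
  unfold stepFilter at hC₁
  rw [eventually_prod_principal_iff] at hC₁
  obtain ⟨h₀, hh₀, hsub⟩ := mem_nhdsGT_iff_exists_Ioo_subset.1 hC₁
  obtain ⟨C₂, hC₂⟩ := (hK.prod (isCompact_Icc (a := 0) (b := T))).exists_bound_of_continuousOn
    ((contDiffOn_iterate_dirDeriv (uniqueDiffOn_slab hΩ hT) (0, 1) hu (R + 1)).continuousOn.mono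
      (Set.prod_mono hKΩ le_rfl))
  refine ⟨C₂ * τ ^ (R + 1) + C₁, h₀, hh₀, fun h hh hhh a ha x hx t ht htT => ?_⟩
  have hδ : 0 < τ * h := mul_pos hτ hh
  have htI : t ∈ Set.Icc 0 T := ⟨ht, by linarith⟩
  have htaylor := norm_sub_taylor_le (convex_Icc (0 : ℝ) T) (C := C₂) (R + 1)
    (fun l s => (slabDt Ω T)^[l] G (x, s))
    (fun l _ s hs => hasDerivWithinAt_iterate_slabDt hΩ hT hu l (hKΩ hx) hs)
    (fun s hs => hC₂ (x, s) ⟨hx, hs⟩) htI ⟨by linarith, htT⟩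
  have hmain := hsub ⟨hh, hhh⟩ (x, t, a) ⟨hx, htI, abs_le.1 ha⟩
  rw [add_sub_cancel_left, abs_of_pos hδ] at htaylor
  rw [norm_pow, Real.norm_eq_abs, abs_of_pos hh] at hmain
  simp only [Int.cast_zero, zero_mul, add_zero, smul_sub, Finset.sum_sub_distrib] at hmain
  have e : ∑ l ∈ Finset.range (R + 1), ((τ * h) ^ l / (l.factorial : ℝ)) •
      (slabDt Ω T)^[l] G (x, t) = u x t + ∑ l ∈ Finset.Icc 1 R,
        ((τ * h) ^ l / (l.factorial : ℝ)) • (slabDt Ω T)^[l] G (x, t) := by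
    rw [Finset.range_eq_Ico, Finset.sum_eq_sum_Ico_succ_bot (Nat.succ_pos R)]
    simp [hG, Finset.Ico_add_one_right_eq_Icc]
  rw [e] at htaylor
  -- With `S` the exact Taylor sum, the error splits into the Taylor remainder of `u` in time and
  -- the weighted errors of the approximate derivatives.
  have e2 : ∀ B S V W : Fin m → ℝ, B - (V + W) = (B - (V + S)) - (W - S) := by
    intros; abel
  unfold lwStep
  rw [e2 _ (∑ l ∈ Finset.Icc 1 R, ((τ * h) ^ l / (l.factorial : ℝ)) •
    (slabDt Ω T)^[l] G (x, t))]
  simp only [Int.cast_zero, zero_mul, add_zero]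
  calc _ ≤ C₂ * (τ * h) ^ (R + 1) + C₁ * h ^ (R + 1) :=
        (norm_sub_le _ _).trans (add_le_add htaylor hmain)
    _ = _ := by ring

end
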